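/- **Theorem (Density of smooth functions).** Let $n\ge 1$ and let $\Omega\subset\mathbb R^n$ be a bounded Lipschitz domain (a bounded open set which near every boundary point is, up to a rigid motion, the strict epigraph of a Lipschitz function; connectedness is not needed). For $1<p<q<\infty$ and a measurable $a:\Omega\to[0,\infty)$ put $M(x,t)=t^p+a(x)t^q$ and $$W(\Omega)=\Big\{\varphi\in W^{1,1}_0(\Omega):\ \int_\Omega M(x,|\nabla\varphi|)\,dx<\infty\Big\},\qquad \|v\|_{W(\Omega)}=\|v\|_{L^1(\Omega)}+\|\nabla v\|_{L_M(\Omega)},$$ where $W^{1,1}_0(\Omega)$ is the closure of $C_c^\infty(\Omega)$ in $W^{1,1}(\Omega)$ and $\|\xi\|_{L_M(\Omega)}=\inf\{\lambda>0:\int_\Omega M(x,|\xi(x)|/\lambda)\,dx\le 1\}$. For $\varkappa>0$ write $a\in\mathcal Z^{\varkappa}(\Omega)$ if there is a constant $C>0$ with $a(x)\le C\,(a(y)+|x-y|^{\varkappa})$ for all $x,y\in\Omega$. There is a constant $c>0$, depending only on $\Omega$, such that for all $1<p<q<\infty$, $\varkappa>0$ and all measurable $a\in\mathcal Z^{\varkappa}(\Omega)$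 the following hold. 1. If $\varkappa\ge q-p$, then for every $\varphi\in W(\Omega)$ there is a sequence $(\varphi_k)_k\subset C_c^\infty(\Omega)$ with $\varphi_k\to\varphi$ in the norm of $W(\Omega)$. 2. If $\gamma\in(0,1]$ and $\varkappa\ge(q-p)(1-\gamma)$, then for every $\varphi\in W(\Omega)\cap C^{0,\gamma}(\Omega)$ there is a sequence $(\varphi_k)_k\subset C_c^\infty(\Omega)$ with $\varphi_k\to\varphi$ in the norm of $W(\Omega)$. Here $C^{0,\gamma}(\Omega)$ is the set of $f$ for which there is $H\ge 0$ with $|f(x)-f(y)|\le H|x-y|^\gamma$ for all $x,y\in\Omega$. In both cases, if moreover $\varphi\in L^\infty(\Omega)$, the sequence can be chosen so that also $\|\varphi_k\|_{L^\infty(\Omega)}\le c\,\|\varphi\|_{L^\infty(\Omega)}$ for all $k$. Finally, for $u$ and $u_k$ $(k\in\mathbb N)$ in $W(\Omega)$, one has $\|u_k-u\|_{W(\Omega)}\to0$ if and only if $u_k\to u$ in $L^1(\Omega)$ and $\int_\Omega M(x,|\nabla u_k-\nabla u|)\,dx\to0$. -/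

import Mathlib

open Filter Topology MeasureTheory
open scoped NNReal ENNReal ContDiff

noncomputable section

namespace DoublePhase

/-- Euclidean space `ℝⁿ`. -/
abbrev E (n : ℕ) : Type := EuclideanSpace ℝ (Fin n)

/-- Bounded Lipschitz domains: bounded open sets which, near every boundary point and for a
suitable unit vector `e`, are the strict epigraph in direction `e` of a Lipschitz function `g`
of the component `y - ⟪e, y⟫ e` of `y` in the hyperplane orthogonal to `e`.
Connectedness is not required. -/
structure IsBoundedLipschitzDomain {n : ℕ} (Ω : Set (E n)) : Prop where
  isOpen : IsOpen Ω
  isBounded : Bornology.IsBounded Ω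
  lipschitz_boundary : ∀ x ∈ frontier Ω, ∃ (r : ℝ) (e : E n) (K : ℝ≥0) (g : E n → ℝ),
    0 < r ∧ ‖e‖ = 1 ∧ LipschitzWith K g ∧
      ∀ y ∈ Metric.ball x r, (y ∈ Ω ↔ g (y - inner ℝ e y • e) < inner ℝ e y)

/-- The class `C_c^∞(Ω)`; its members are functions on `ℝⁿ` that vanish off a compact subset
of `Ω`. -/
structure IsTestFunction {n : ℕ} (Ω : Set (E n)) (ψ : E n → ℝ) : Prop where
  contDiff : ContDiff ℝ ∞ ψ
  hasCompactSupport : HasCompactSupport ψ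
  tsupport_subset : tsupport ψ ⊆ Ω

/-- `G` is a weak (distributional) gradient of `u` in `Ω`. -/
structure IsWeakGradient {n : ℕ} (Ω : Set (E n)) (u : E n → ℝ) (G : E n → E n) : Prop where
  locallyIntegrable : LocallyIntegrableOn u Ω
  locallyIntegrable_grad : LocallyIntegrableOn G Ω
  integral_eq : ∀ ψ : E n → ℝ, IsTestFunction Ω ψ →
    ∫ x in Ω, u x • gradient ψ x = -∫ x in Ω, ψ x • G x

open Classical in
/-- The weak gradient of `u` in `Ω` (unique up to a null set on open `Ω`); by convention `0` when
`u` has none. -/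
def weakGradient {n : ℕ} (Ω : Set (E n)) (u : E n → ℝ) : E n → E n :=
  if h : ∃ G, IsWeakGradient Ω u G then h.choose else 0

/-- `u ∈ W^{1,1}(Ω)`. -/
def MemW11 {n : ℕ} (Ω : Set (E n)) (u : E n → ℝ) : Prop :=
  IntegrableOn u Ω ∧ ∃ G, IsWeakGradient Ω u G ∧ IntegrableOn G Ω

/-- `u ∈ W_0^{1,1}(Ω)`, the closure of `C_c^∞(Ω)` in `W^{1,1}(Ω)`. -/
def MemW11Zero {n : ℕ} (Ω : Set (E n)) (u : E n → ℝ) : Prop :=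
  MemW11 Ω u ∧ ∃ ψ : ℕ → E n → ℝ, (∀ k, IsTestFunction Ω (ψ k)) ∧
    Tendsto (fun k => eLpNorm (fun x => ψ k x - u x) 1 (volume.restrict Ω)
      + eLpNorm (fun x => gradient (ψ k) x - weakGradient Ω u x) 1 (volume.restrict Ω))
      atTop (𝓝 0)

/-- The class `𝒵^ϰ(Ω)` of nonnegative weights. -/
def MemZ {n : ℕ} (Ω : Set (E n)) (ϰ : ℝ) (a : E n → ℝ) : Prop :=
  (∀ x ∈ Ω, 0 ≤ a x) ∧
    ∃ C : ℝ, 0 < C ∧ ∀ x ∈ Ω, ∀ y ∈ Ω, a x ≤ C * (a y + ‖x - y‖ ^ ϰ)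

/-- The modular `∫_Ω M(x, |ξ(x)|) dx` with `M(x, t) = t ^ p + a(x) t ^ q`. -/
def modular {n : ℕ} (Ω : Set (E n)) (p q : ℝ) (a : E n → ℝ) (ξ : E n → E n) : ℝ≥0∞ :=
  ∫⁻ x in Ω, ENNReal.ofReal (‖ξ x‖ ^ p + a x * ‖ξ x‖ ^ q)

/-- The Luxemburg norm of `L_M(Ω)`, with value `∞` if no `t` is admissible. -/
def luxemburgNorm {n : ℕ} (Ω : Set (E n)) (p q : ℝ) (a : E n → ℝ) (ξ : E n → E n) : ℝ≥0∞ :=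
  ⨅ (t : ℝ≥0) (_ : 0 < t) (_ : modular Ω p q a (fun x => (t : ℝ)⁻¹ • ξ x) ≤ 1), (t : ℝ≥0∞)

/-- `u ∈ W(Ω)`, that is `u ∈ W_0^{1,1}(Ω)` and `∫_Ω M(x, |∇u|) dx < ∞`. -/
def MemW {n : ℕ} (Ω : Set (E n)) (p q : ℝ) (a : E n → ℝ) (u : E n → ℝ) : Prop :=
  MemW11Zero Ω u ∧ modular Ω p q a (weakGradient Ω u) < ⊤

/-- The norm `‖v‖_{L¹(Ω)} + ‖∇v‖_{L_M(Ω)}` of `W(Ω)`. -/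
def wNorm {n : ℕ} (Ω : Set (E n)) (p q : ℝ) (a : E n → ℝ) (v : E n → ℝ) : ℝ≥0∞ :=
  eLpNorm v 1 (volume.restrict Ω) + luxemburgNorm Ω p q a (weakGradient Ω v)

/-- `u k → u` in the norm of `W(Ω)`. -/
def TendstoW {n : ℕ} (Ω : Set (E n)) (p q : ℝ) (a : E n → ℝ) (u : ℕ → E n → ℝ)
    (v : E n → ℝ) : Prop :=
  Tendsto (fun k => wNorm Ω p q a (fun x => u k x - v x)) atTop (𝓝 0)

/-- `φ` is the limit in `W(Ω)` of a sequence in `C_c^∞(Ω)` which, if `φ` is essentially bounded,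
satisfies `‖ψ_k‖_∞ ≤ c ‖φ‖_∞`. -/
def SmoothlyApproximable {n : ℕ} (Ω : Set (E n)) (p q : ℝ) (a : E n → ℝ) (c : ℝ≥0)
    (φ : E n → ℝ) : Prop :=
  ∃ ψ : ℕ → E n → ℝ, (∀ k, IsTestFunction Ω (ψ k)) ∧ TendstoW Ω p q a ψ φ ∧
    (MemLp φ ⊤ (volume.restrict Ω) → ∀ k,
      eLpNorm (ψ k) ⊤ (volume.restrict Ω) ≤ c * eLpNorm φ ⊤ (volume.restrict Ω))

end DoublePhase

end

/-!
Extended by zero, a function `φ` of `W(Ω)` is the limit in `W^{1,1}(ℝⁿ)` of test functions of `Ω`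
(`IsSobolevLimit`), so its mollifications have the mollified gradient on all of `ℝⁿ`. The
approximating functions are mollifications of the pieces `θᵢ φ` of a partition of unity of the
closure of `Ω`. The kernel for the piece `θᵢ φ` is supported in a small ball around `δ • eᵢ` rather
than around `0`, where `eᵢ` points into `Ω` along the support of `θᵢ`
(`IsBoundedLipschitzDomain.exists_inward_cone`); this makes the mollifications test functions of
`Ω`, and their sum is at most the number of pieces times the supremum of `|φ|`.

The point is that mollification at scale `δ` is bounded for the modular, uniformly in `δ`. Let
`g` be the mollified gradient. Jensen's inequality controls `‖g‖ ^ p`, and also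
`a ‖g‖ ^ q` as long as the value of `a` at `x` is replaced by a lower bound for `a` near `x`. By the
condition `𝒵^ϰ`, the error of this replacement is of order `δ ^ ϰ ‖g‖ ^ q`, and
`‖g‖ ^ (q - p)` is at most a multiple of `δ ^ ((γ - 1) (q - p))` if `φ` is `γ`-Hölder continuous,
or merely bounded when `γ = 0`. Under the assumption on the exponents the powers of `δ` combine to
something bounded (`doublePhase_mollify_le`), so that the integrands are dominated by mollifications
of one integrable function, which converge in `L¹`; modular convergence follows by dominated
convergence (`IsMollifierSeq.tendsto_modular`).

The case of a general `φ` with `q - p ≤ ϰ` is reduced to bounded functions by a smooth truncation.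
For `φ` Hölder continuous in `Ω`, the extension by zero is Hölder continuous in `ℝⁿ` because
`φ` vanishes on the boundary: if `|φ|` were bounded below near a boundary point, a smooth
function of `φ` would agree there with the indicator function of `Ω` and have zero gradient, so it
would be constant across the boundary (`IsSobolevLimit.not_le_abs_near_frontier`).

Norm and modular convergence of gradients agree since `t ^ p + a t ^ q` is doubling
(`tendsto_luxemburgNorm_iff`), and weak gradients are additive up to null sets.
-/

open Filter Topology MeasureTheory Metric
open scoped NNReal ENNReal ContDiff Convolution

namespace DoublePhase

variable {n : ℕ}

/-! ### Mollifiers supported off centre -/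

/-- The convolution `k * f` of a scalar kernel with a vector-valued function. -/
noncomputable def mollify {F : Type*} [NormedAddCommGroup F] [NormedSpace ℝ F]
    (k : E n → ℝ) (f : E n → F) : E n → F :=
  k ⋆[ContinuousLinearMap.lsmul ℝ ℝ, volume] f

/-- A sequence of nonnegative smooth kernels of mass one, the `j`-th of which is supported in the
ball of radius `δ j * η` around `δ j • e`. A nonzero `e` makes the mollification translate by
`δ j • e` as well, which moves supports into a Lipschitz domain. The constant `C` bounds the
gradients in `L¹`, at the scale `δ j`. -/
structure IsMollifierSeq (k : ℕ → E n → ℝ) (δ : ℕ → ℝ) (e : E n) (η C : ℝ) : Prop where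
  pos : ∀ j, 0 < δ j
  tendsto : Tendsto δ atTop (𝓝 0)
  contDiff : ∀ j, ContDiff ℝ ∞ (k j)
  nonneg : ∀ j x, 0 ≤ k j x
  tsupport_subset : ∀ j, tsupport (k j) ⊆ closedBall (δ j • e) (δ j * η)
  integral_eq : ∀ j, ∫ x, k j x = 1
  integral_fderiv_le : ∀ j, ∫ x, ‖fderiv ℝ (k j) x‖ ≤ C / δ j

/-- Rescalings of one bump function centred at `e`; in particular `C` is the same for all sequences
of scales. -/
theorem exists_isMollifierSeq (e : E n) {η : ℝ} (hη : 0 < η) :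
    ∃ C, ∀ δ : ℕ → ℝ, (∀ j, 0 < δ j) → Tendsto δ atTop (𝓝 0) →
      ∃ k, IsMollifierSeq k δ e η C := by
  let f : ContDiffBump e := ⟨η / 2, η, by positivity, by linarith⟩
  set ρ := f.normed volume with hρ
  have hρd : ContDiff ℝ ∞ ρ := f.contDiff_normed
  refine ⟨∫ x, ‖fderiv ℝ ρ x‖, fun δ hδ hδ0 =>
    ⟨fun j x => ((δ j) ^ n)⁻¹ * ρ ((δ j)⁻¹ • x), hδ, hδ0, fun j => ?_, fun j x => ?_, fun j => ?_,
      fun j => ?_, fun j => ?_⟩⟩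
  · exact contDiff_const.mul (hρd.comp (contDiff_const_smul _))
  · have := (hδ j).le
    have := f.nonneg_normed (μ := volume) ((δ j)⁻¹ • x)
    positivity
  · refine closure_minimal (fun x hx => ?_) isClosed_closedBall
    have hx' : ρ ((δ j)⁻¹ • x) ≠ 0 := right_ne_zero_of_mul hx
    have h1 : (δ j)⁻¹ • x ∈ closedBall e η := by
      have : (δ j)⁻¹ • x ∈ Function.support ρ := hx'
      rw [hρ, f.support_normed_eq] at this
      exact ball_subset_closedBall this
    have h2 : x = δ j • ((δ j)⁻¹ • x) := by rw [smul_inv_smul₀ (hδ j).ne']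
    rw [mem_closedBall, dist_eq_norm] at h1 ⊢
    rw [h2, ← smul_sub, norm_smul, Real.norm_of_nonneg (hδ j).le]
    exact mul_le_mul_of_nonneg_left h1 (hδ j).le
  · rw [integral_const_mul, Measure.integral_comp_inv_smul_of_nonneg _ _ (hδ j).le]
    simp only [finrank_euclideanSpace, Fintype.card_fin, smul_eq_mul]
    rw [hρ, f.integral_normed, mul_one, inv_mul_cancel₀ (pow_pos (hδ j) n).ne']
  · have hd : ∀ x, fderiv ℝ (fun x => ((δ j) ^ n)⁻¹ * ρ ((δ j)⁻¹ • x)) x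
        = ((δ j) ^ n)⁻¹ • (δ j)⁻¹ • fderiv ℝ ρ ((δ j)⁻¹ • x) := by
      intro x
      rw [← fderiv_comp_smul]
      exact fderiv_const_smul (f := fun x => ρ ((δ j)⁻¹ • x))
        ((hρd.comp (contDiff_const_smul ((δ j)⁻¹))).differentiable (by simp) x) (((δ j) ^ n)⁻¹ : ℝ)
    have h0 := (hδ j).le
    simp only [hd, norm_smul, Real.norm_of_nonneg (inv_nonneg.2 h0),
      Real.norm_of_nonneg (inv_nonneg.2 (pow_nonneg h0 n))]
    rw [integral_const_mul, integral_const_mul,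
      Measure.integral_comp_inv_smul_of_nonneg volume (fun x => ‖fderiv ℝ ρ x‖) h0]
    simp only [finrank_euclideanSpace, Fintype.card_fin, smul_eq_mul]
    apply le_of_eq
    have := (hδ j).ne'
    field_simp

namespace IsMollifierSeq

variable {k : ℕ → E n → ℝ} {δ : ℕ → ℝ} {e : E n} {η C : ℝ}

theorem hasCompactSupport (h : IsMollifierSeq k δ e η C) (j : ℕ) : HasCompactSupport (k j) :=
  (isCompact_closedBall _ _).of_isClosed_subset (isClosed_tsupport _) (h.tsupport_subset j)

theorem integrable (h : IsMollifierSeq k δ e η C) (j : ℕ) : Integrable (k j) :=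
  (h.contDiff j).continuous.integrable_of_hasCompactSupport (h.hasCompactSupport j)

theorem norm_le (h : IsMollifierSeq k δ e η C) {j : ℕ} {x : E n} (hx : x ∈ tsupport (k j)) :
    ‖x‖ ≤ δ j * (‖e‖ + η) := by
  have := h.tsupport_subset j hx
  rw [mem_closedBall, dist_eq_norm] at this
  calc ‖x‖ = ‖(x - δ j • e) + δ j • e‖ := by simp
    _ ≤ δ j * η + δ j * ‖e‖ := (norm_add_le _ _).trans (add_le_add this
        (by rw [norm_smul, Real.norm_of_nonneg (h.pos j).le]))
    _ = _ := by ring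

theorem lintegral_eq (h : IsMollifierSeq k δ e η C) (j : ℕ) :
    ∫⁻ x, ENNReal.ofReal (k j x) = 1 := by
  rw [← ofReal_integral_eq_lintegral_ofReal (h.integrable j)
    (Eventually.of_forall (h.nonneg j)), h.integral_eq, ENNReal.ofReal_one]

end IsMollifierSeq

/-- Translations act continuously on `L¹`. -/
theorem tendsto_eLpNorm_translate_sub {F : Type*} [NormedAddCommGroup F] {h : E n → F}
    (hh : Integrable h) :
    Tendsto (fun z => eLpNorm (fun x => h (x - z) - h x) 1 volume) (𝓝 0) (𝓝 0) := by
  have hm : MemLp h 1 volume := memLp_one_iff_integrable.2 hh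
  have : Fact ((1 : ℝ≥0∞) ≠ ⊤) := ⟨ENNReal.one_ne_top⟩
  have key : Tendsto (fun z : E n => (DomAddAct.mk (-z)) +ᵥ hm.toLp h) (𝓝 0)
      (𝓝 (DomAddAct.mk (-0 : E n) +ᵥ hm.toLp h)) := by
    have hc : Continuous (fun z : E n => DomAddAct.mk (-z)) :=
      DomAddAct.continuous_mk.comp continuous_neg
    exact (hc.vadd continuous_const).tendsto 0
  rw [tendsto_iff_edist_tendsto_0] at key
  refine key.congr fun z => ?_
  rw [neg_zero, DomAddAct.mk_zero, zero_vadd, DomAddAct.mk_vadd_toLp, Lp.edist_toLp_toLp]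
  refine congrArg (fun f => eLpNorm f 1 volume) ?_
  ext x
  simp [neg_add_eq_sub]

variable {F : Type*} [NormedAddCommGroup F] [NormedSpace ℝ F]

theorem mollify_apply (k : E n → ℝ) (f : E n → F) (x : E n) :
    mollify k f x = ∫ t, k t • f (x - t) := rfl

theorem mollify_apply_swap (k : E n → ℝ) (f : E n → F) (x : E n) :
    mollify k f x = ∫ t, k (x - t) • f t := by
  rw [mollify, convolution_lsmul_swap]

theorem integrable_mollify_integrand {k : E n → ℝ} (hk : Continuous k) (hk' : HasCompactSupport k)
    {f : E n → F} (hf : LocallyIntegrable f) (x : E n) :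
    Integrable fun t => k t • f (x - t) :=
  (hk'.convolutionExists_left (ContinuousLinearMap.lsmul ℝ ℝ) hk hf x)

theorem continuous_mollify {k : E n → ℝ} (hk : Continuous k) (hk' : HasCompactSupport k)
    {f : E n → F} (hf : LocallyIntegrable f) : Continuous (mollify k f) :=
  hk'.continuous_convolution_left _ hk hf

theorem IsMollifierSeq.tendsto_eLpNorm_mollify_sub [CompleteSpace F] {k : ℕ → E n → ℝ}
    {δ : ℕ → ℝ} {e : E n} {η C : ℝ} (hk : IsMollifierSeq k δ e η C) {h : E n → F}
    (hh : Integrable h) :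
    Tendsto (fun j => eLpNorm (fun x => mollify (k j) h x - h x) 1 volume) atTop (𝓝 0) := by
  rw [ENNReal.tendsto_nhds_zero]
  intro ε hε
  have h1 := (ENNReal.tendsto_nhds_zero.1 (tendsto_eLpNorm_translate_sub hh)) ε hε
  obtain ⟨r, hr, hball⟩ := Metric.eventually_nhds_iff.1 h1
  have h2 : ∀ᶠ j in atTop, δ j * (‖e‖ + η) < r := by
    have : Tendsto (fun j => δ j * (‖e‖ + η)) atTop (𝓝 (0 * (‖e‖ + η))) :=
      hk.tendsto.mul_const _
    rw [zero_mul] at this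
    exact this.eventually_lt_const hr
  filter_upwards [h2] with j hj
  have hpt : ∀ x, ‖mollify (k j) h x - h x‖ₑ
      ≤ ∫⁻ t, ENNReal.ofReal (k j t) * ‖h (x - t) - h x‖ₑ := by
    intro x
    have : mollify (k j) h x - h x = ∫ t, k j t • (h (x - t) - h x) := by
      simp only [smul_sub]
      rw [integral_sub (integrable_mollify_integrand (hk.contDiff j).continuous
        (hk.hasCompactSupport j) hh.locallyIntegrable x) ((hk.integrable j).smul_const _),
        ← mollify_apply]
      rw [integral_smul_const, hk.integral_eq, one_smul]
    rw [this]
    refine (enorm_integral_le_lintegral_enorm _).trans (le_of_eq ?_)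
    refine lintegral_congr fun t => ?_
    rw [enorm_smul, Real.enorm_of_nonneg (hk.nonneg j t)]
  have hmeas : AEMeasurable (fun z : E n × E n =>
      ENNReal.ofReal (k j z.2) * ‖h (z.1 - z.2) - h z.1‖ₑ) (volume.prod volume) := by
    have a1 : AEStronglyMeasurable (fun z : E n × E n => h (z.1 - z.2)) (volume.prod volume) :=
      hh.1.comp_quasiMeasurePreserving (quasiMeasurePreserving_sub _ _)
    have a2 : AEStronglyMeasurable (fun z : E n × E n => h z.1) (volume.prod volume) :=
      hh.1.comp_fst
    have a3 : Measurable (fun z : E n × E n => ENNReal.ofReal (k j z.2)) :=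
      ENNReal.measurable_ofReal.comp ((hk.contDiff j).continuous.measurable.comp measurable_snd)
    exact a3.aemeasurable.mul (a1.sub a2).enorm
  rw [eLpNorm_one_eq_lintegral_enorm]
  calc ∫⁻ x, ‖mollify (k j) h x - h x‖ₑ
      ≤ ∫⁻ x, ∫⁻ t, ENNReal.ofReal (k j t) * ‖h (x - t) - h x‖ₑ := lintegral_mono hpt
    _ = ∫⁻ t, ∫⁻ x, ENNReal.ofReal (k j t) * ‖h (x - t) - h x‖ₑ :=
        lintegral_lintegral_swap hmeas
    _ = ∫⁻ t, ENNReal.ofReal (k j t) * ∫⁻ x, ‖h (x - t) - h x‖ₑ :=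
        lintegral_congr fun t => lintegral_const_mul' _ _ ENNReal.ofReal_ne_top
    _ ≤ ∫⁻ t, ENNReal.ofReal (k j t) * ε := by
        refine lintegral_mono fun t => ?_
        by_cases ht : k j t = 0
        · simp [ht]
        · have := hball (y := t) (by
            rw [dist_zero_right]
            exact (hk.norm_le (subset_tsupport _ ht)).trans_lt hj)
          rw [eLpNorm_one_eq_lintegral_enorm] at this
          gcongr
    _ = ε := by
        rw [lintegral_mul_const _ (hk.contDiff j).continuous.measurable.ennreal_ofReal,
          hk.lintegral_eq, one_mul]

/-! ### Weak gradients -/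

theorem IsTestFunction.integrable {Ω : Set (E n)} {ψ : E n → ℝ} (h : IsTestFunction Ω ψ) :
    Integrable ψ :=
  h.contDiff.continuous.integrable_of_hasCompactSupport h.hasCompactSupport

theorem continuous_gradient {ψ : E n → ℝ} (h : ContDiff ℝ ∞ ψ) : Continuous (gradient ψ) :=
  (InnerProductSpace.toDual ℝ (E n)).symm.continuous.comp (h.continuous_fderiv (by simp))

theorem norm_gradient (ψ : E n → ℝ) (x : E n) : ‖gradient ψ x‖ = ‖fderiv ℝ ψ x‖ :=
  (InnerProductSpace.toDual ℝ (E n)).symm.norm_map _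

theorem gradient_eq_zero_of_notMem_tsupport {ψ : E n → ℝ} {x : E n} (hx : x ∉ tsupport ψ) :
    gradient ψ x = 0 := by
  rw [gradient, fderiv_of_notMem_tsupport (𝕜 := ℝ) hx, map_zero]

theorem hasCompactSupport_gradient {ψ : E n → ℝ} (h : HasCompactSupport ψ) :
    HasCompactSupport (gradient ψ) :=
  HasCompactSupport.intro h fun _ hx => gradient_eq_zero_of_notMem_tsupport hx

namespace IsTestFunction

variable {Ω : Set (E n)} {ψ : E n → ℝ}

theorem integrable_gradient (h : IsTestFunction Ω ψ) : Integrable (gradient ψ) :=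
  (continuous_gradient h.contDiff).integrable_of_hasCompactSupport
    (hasCompactSupport_gradient h.hasCompactSupport)

theorem eq_zero (h : IsTestFunction Ω ψ) {x : E n} (hx : x ∉ Ω) : ψ x = 0 :=
  image_eq_zero_of_notMem_tsupport fun hx' => hx (h.tsupport_subset hx')

theorem gradient_eq_zero (h : IsTestFunction Ω ψ) {x : E n} (hx : x ∉ Ω) : gradient ψ x = 0 :=
  gradient_eq_zero_of_notMem_tsupport fun hx' => hx (h.tsupport_subset hx')

theorem exists_bound (h : IsTestFunction Ω ψ) :
    ∃ A, 0 ≤ A ∧ (∀ x, |ψ x| ≤ A) ∧ ∀ x, ‖gradient ψ x‖ ≤ A := by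
  obtain ⟨A, hA⟩ := h.contDiff.continuous.bounded_above_of_compact_support h.hasCompactSupport
  obtain ⟨B, hB⟩ := (continuous_gradient h.contDiff).bounded_above_of_compact_support
    (hasCompactSupport_gradient h.hasCompactSupport)
  exact ⟨max A B, (norm_nonneg _).trans ((hA 0).trans (le_max_left _ _)),
    fun x => (hA x).trans (le_max_left _ _), fun x => (hB x).trans (le_max_right _ _)⟩

/-- Integration by parts for test functions. -/
theorem integral_smul_gradient {Ω' : Set (E n)} {v : E n → ℝ} (h : IsTestFunction Ω ψ)
    (hv : IsTestFunction Ω' v) : ∫ x, v x • gradient ψ x = -∫ x, ψ x • gradient v x := by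
  have i1 : Integrable (fun x => v x • gradient ψ x) :=
    (hv.contDiff.continuous.smul (continuous_gradient h.contDiff)).integrable_of_hasCompactSupport
      hv.hasCompactSupport.smul_right
  have i2 : Integrable (fun x => ψ x • gradient v x) :=
    (h.contDiff.continuous.smul (continuous_gradient hv.contDiff)).integrable_of_hasCompactSupport
      h.hasCompactSupport.smul_right
  refine ext_inner_left ℝ fun w => ?_
  rw [inner_neg_right, ← integral_inner i1, ← integral_inner i2]
  have e1 : ∀ (f : E n → ℝ) x, inner ℝ w (gradient f x) = fderiv ℝ f x w := by
    intro f x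
    rw [real_inner_comm, gradient, InnerProductSpace.toDual_symm_apply]
  simp only [inner_smul_right, e1]
  have j1 : Integrable (fun x => fderiv ℝ v x w * ψ x) := by
    have := i2.inner_const (𝕜 := ℝ) w
    refine this.congr (Eventually.of_forall fun x => ?_)
    simp only
    rw [real_inner_comm, inner_smul_right, e1, mul_comm]
  have j2 : Integrable (fun x => v x * fderiv ℝ ψ x w) := by
    have := i1.inner_const (𝕜 := ℝ) w
    refine this.congr (Eventually.of_forall fun x => ?_)
    simp only
    rw [real_inner_comm, inner_smul_right, e1]
  have j3 : Integrable (fun x => v x * ψ x) :=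
    (hv.contDiff.continuous.mul h.contDiff.continuous).integrable_of_hasCompactSupport
      hv.hasCompactSupport.mul_right
  rw [integral_mul_fderiv_eq_neg_fderiv_mul_of_integrable j1 j2 j3
    (fun x _ => hv.contDiff.differentiable (by simp) x)
    (fun x _ => h.contDiff.differentiable (by simp) x)]
  simp only [mul_comm]

end IsTestFunction

section

variable {F : Type*} [NormedAddCommGroup F] [NormedSpace ℝ F] {Ω : Set (E n)} {ψ : E n → ℝ}

theorem IsTestFunction.integrable_smul (h : IsTestFunction Ω ψ) {f : E n → F}
    (hf : LocallyIntegrableOn f Ω) : Integrable (fun x => ψ x • f x) := by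
  have h1 : IntegrableOn f (tsupport ψ) :=
    hf.integrableOn_compact_subset h.tsupport_subset h.hasCompactSupport
  have h2 : IntegrableOn (fun x => ψ x • f x) (tsupport ψ) :=
    h1.continuousOn_smul h.contDiff.continuous.continuousOn h.hasCompactSupport
  rw [← integrableOn_iff_integrable_of_support_subset (s := tsupport ψ)]
  · exact h2
  · exact (Function.support_smul_subset_left _ _).trans (subset_tsupport _)

theorem IsTestFunction.setIntegral_smul (h : IsTestFunction Ω ψ) (f : E n → F) :
    ∫ x in Ω, ψ x • f x = ∫ x, ψ x • f x :=
  setIntegral_eq_integral_of_forall_compl_eq_zero fun x hx => by rw [h.eq_zero hx, zero_smul]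

theorem IsTestFunction.integrable_smul_gradient (h : IsTestFunction Ω ψ) {f : E n → ℝ}
    (hf : LocallyIntegrableOn f Ω) : Integrable (fun x => f x • gradient ψ x) := by
  have h1 : IntegrableOn f (tsupport ψ) :=
    hf.integrableOn_compact_subset h.tsupport_subset h.hasCompactSupport
  have h2 : IntegrableOn (fun x => f x • gradient ψ x) (tsupport ψ) :=
    h1.smul_continuousOn (continuous_gradient h.contDiff).continuousOn h.hasCompactSupport
  rw [← integrableOn_iff_integrable_of_support_subset (s := tsupport ψ)]
  · exact h2
  · intro x hx
    by_contra h'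
    exact hx (by simp only [gradient_eq_zero_of_notMem_tsupport h', smul_zero])

end

namespace IsWeakGradient

variable {Ω : Set (E n)} {u v : E n → ℝ} {G H : E n → E n}

theorem sub (hu : IsWeakGradient Ω u G) (hv : IsWeakGradient Ω v H) :
    IsWeakGradient Ω (fun x => u x - v x) (fun x => G x - H x) := by
  refine ⟨hu.1.sub hv.1, hu.2.sub hv.2, fun ψ hψ => ?_⟩
  simp only [sub_smul, smul_sub]
  rw [integral_sub (hψ.integrable_smul_gradient hu.1).integrableOn
      (hψ.integrable_smul_gradient hv.1).integrableOn,
    integral_sub (hψ.integrable_smul hu.2).integrableOn (hψ.integrable_smul hv.2).integrableOn,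
    hu.3 ψ hψ, hv.3 ψ hψ]
  abel

theorem ae_eq (hΩ : IsOpen Ω) (hu : IsWeakGradient Ω u G) (hv : IsWeakGradient Ω u H) :
    G =ᵐ[volume.restrict Ω] H := by
  have := hΩ.ae_eq_zero_of_integral_contDiff_smul_eq_zero (μ := volume)
    (f := fun x => G x - H x) (hu.2.sub hv.2) (fun g h1 h2 h3 => by
      have hg : IsTestFunction Ω g := ⟨h1, h2, h3⟩
      simp only [smul_sub]
      rw [integral_sub (hg.integrable_smul hu.2) (hg.integrable_smul hv.2),
        ← hg.setIntegral_smul, ← hg.setIntegral_smul, sub_eq_zero]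
      exact neg_injective ((hu.3 g hg).symm.trans (hv.3 g hg)))
  rw [EventuallyEq, ae_restrict_iff' hΩ.measurableSet]
  filter_upwards [this] with x hx hxΩ
  exact sub_eq_zero.1 (hx hxΩ)

theorem weakGradient_ae_eq (hΩ : IsOpen Ω) (hu : IsWeakGradient Ω u G) :
    weakGradient Ω u =ᵐ[volume.restrict Ω] G := by
  have h : ∃ G, IsWeakGradient Ω u G := ⟨G, hu⟩
  rw [weakGradient, dif_pos h]
  exact h.choose_spec.ae_eq hΩ hu

end IsWeakGradient

theorem MemW11.isWeakGradient {Ω : Set (E n)} {u : E n → ℝ} (h : MemW11 Ω u) :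
    IsWeakGradient Ω u (weakGradient Ω u) := by
  have h' : ∃ G, IsWeakGradient Ω u G := ⟨_, h.2.choose_spec.1⟩
  rw [weakGradient, dif_pos h']
  exact h'.choose_spec

theorem MemW11.integrableOn_weakGradient {Ω : Set (E n)} (hΩ : IsOpen Ω) {u : E n → ℝ}
    (h : MemW11 Ω u) : IntegrableOn (weakGradient Ω u) Ω := by
  obtain ⟨-, G, hG, hGi⟩ := h
  exact hGi.congr (hG.weakGradient_ae_eq hΩ).symm

theorem IsTestFunction.isWeakGradient {Ω : Set (E n)} {v : E n → ℝ} (hv : IsTestFunction Ω v) :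
    IsWeakGradient Ω v (gradient v) := by
  refine ⟨hv.integrable.locallyIntegrable.locallyIntegrableOn _,
    hv.integrable_gradient.locallyIntegrable.locallyIntegrableOn _, fun ψ hψ => ?_⟩
  rw [hψ.setIntegral_smul, hv.setIntegral_smul]
  exact hψ.integral_smul_gradient hv

/-! ### Limits of test functions -/

/-- The pair `(u, G)` is the `L¹(ℝⁿ)` limit of `(ψ, ∇ψ)` for test functions `ψ` of `Ω`: after
extension by zero this is `u ∈ W₀^{1,1}(Ω)` with `G = ∇u`, recorded so that `G` is part of
the data. -/
structure IsSobolevLimit (Ω : Set (E n)) (u : E n → ℝ) (G : E n → E n) : Prop where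
  integrable : Integrable u
  integrable_grad : Integrable G
  exists_seq : ∃ ψ : ℕ → E n → ℝ, (∀ k, IsTestFunction Ω (ψ k)) ∧
    Tendsto (fun k => eLpNorm (fun x => ψ k x - u x) 1 volume) atTop (𝓝 0) ∧
    Tendsto (fun k => eLpNorm (fun x => gradient (ψ k) x - G x) 1 volume) atTop (𝓝 0)

theorem MemW11Zero.isSobolevLimit {Ω : Set (E n)} (hΩ : IsOpen Ω) {u : E n → ℝ}
    (h : MemW11Zero Ω u) :
    IsSobolevLimit Ω (Ω.indicator u) (Ω.indicator (weakGradient Ω u)) := by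
  obtain ⟨h1, ψ, hψ, hlim⟩ := h
  refine ⟨h1.1.integrable_indicator hΩ.measurableSet,
    (h1.integrableOn_weakGradient hΩ).integrable_indicator hΩ.measurableSet, ψ, hψ, ?_, ?_⟩
  · refine tendsto_of_tendsto_of_tendsto_of_le_of_le tendsto_const_nhds hlim (fun _ => zero_le)
      fun k => ?_
    refine le_trans (le_of_eq ?_) le_self_add
    rw [← eLpNorm_indicator_eq_eLpNorm_restrict hΩ.measurableSet]
    congr 1
    ext x
    by_cases hx : x ∈ Ω <;> simp [hx, (hψ k).eq_zero]
  · refine tendsto_of_tendsto_of_tendsto_of_le_of_le tendsto_const_nhds hlim (fun _ => zero_le)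
      fun k => ?_
    refine le_trans (le_of_eq ?_) le_add_self
    rw [← eLpNorm_indicator_eq_eLpNorm_restrict hΩ.measurableSet]
    congr 1
    ext1 x
    by_cases hx : x ∈ Ω <;> simp [hx, (hψ k).gradient_eq_zero]

theorem tendsto_integral_of_norm_sub_le {F H : Type*} [NormedAddCommGroup F]
    [NormedAddCommGroup H] [NormedSpace ℝ H] {f : ℕ → E n → F} {g : E n → F} {f' : ℕ → E n → H}
    {g' : E n → H} {M : ℝ}
    (hf : Tendsto (fun k => eLpNorm (fun x => f k x - g x) 1 volume) atTop (𝓝 0))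
    (hf' : ∀ k, Integrable (f' k)) (hg' : AEStronglyMeasurable g' volume)
    (hM : ∀ k x, ‖f' k x - g' x‖ ≤ M * ‖f k x - g x‖) :
    Tendsto (fun k => ∫ x, f' k x) atTop (𝓝 (∫ x, g' x)) := by
  refine tendsto_integral_of_L1 g' hg' (Eventually.of_forall hf') ?_
  have h1 : Tendsto (fun k => ENNReal.ofReal M * eLpNorm (fun x => f k x - g x) 1 volume) atTop
      (𝓝 0) := by
    simpa using ENNReal.Tendsto.const_mul hf (Or.inr ENNReal.ofReal_ne_top)
  refine tendsto_of_tendsto_of_tendsto_of_le_of_le tendsto_const_nhds h1 (fun _ => zero_le)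
    fun k => ?_
  simp only [eLpNorm_one_eq_lintegral_enorm]
  rw [← lintegral_const_mul' _ _ ENNReal.ofReal_ne_top]
  refine lintegral_mono fun x => ?_
  rw [← ofReal_norm, ← ofReal_norm, ← ENNReal.ofReal_mul' (norm_nonneg _)]
  exact ENNReal.ofReal_le_ofReal (hM k x)

namespace IsSobolevLimit

variable {Ω : Set (E n)} {u : E n → ℝ} {G : E n → E n}

theorem isWeakGradient (h : IsSobolevLimit Ω u G) : IsWeakGradient Ω u G := by
  obtain ⟨hu, hG, v, hv, h1, h2⟩ := h
  refine ⟨hu.locallyIntegrable.locallyIntegrableOn _,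
    hG.locallyIntegrable.locallyIntegrableOn _, fun ψ hψ => ?_⟩
  obtain ⟨A, -, hA, hA'⟩ := hψ.exists_bound
  have e1 : ∫ x in Ω, u x • gradient ψ x = ∫ x, u x • gradient ψ x :=
    setIntegral_eq_integral_of_forall_compl_eq_zero fun x hx => by
      rw [hψ.gradient_eq_zero hx, smul_zero]
  rw [hψ.setIntegral_smul, e1]
  have t1 : Tendsto (fun k => ∫ x, v k x • gradient ψ x) atTop
      (𝓝 (∫ x, u x • gradient ψ x)) := by
    refine tendsto_integral_of_norm_sub_le (M := A) h1
      (fun k => hψ.integrable_smul_gradient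
        ((hv k).integrable.locallyIntegrable.locallyIntegrableOn _))
      (hψ.integrable_smul_gradient (hu.locallyIntegrable.locallyIntegrableOn _)).1
      fun k x => ?_
    rw [← sub_smul, norm_smul, mul_comm]
    gcongr
    exact hA' x
  have t2 : Tendsto (fun k => ∫ x, ψ x • gradient (v k) x) atTop
      (𝓝 (∫ x, ψ x • G x)) := by
    refine tendsto_integral_of_norm_sub_le (M := A) h2
      (fun k => hψ.integrable_smul
        ((hv k).integrable_gradient.locallyIntegrable.locallyIntegrableOn _))
      (hψ.integrable_smul (hG.locallyIntegrable.locallyIntegrableOn _)).1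
      fun k x => ?_
    rw [← smul_sub, norm_smul]
    gcongr
    exact hA x
  refine tendsto_nhds_unique t1 ?_
  simp only [fun k => hψ.integral_smul_gradient (hv k)]
  exact t2.neg

/-- Chain rule for `W₀^{1,1}`. -/
theorem comp (h : IsSobolevLimit Ω u G) {T : ℝ → ℝ} (hT : ContDiff ℝ ∞ T) {B : ℝ}
    (hB : ∀ s, |deriv T s| ≤ B) (hT0 : T 0 = 0) :
    IsSobolevLimit Ω (fun x => T (u x)) (fun x => deriv T (u x) • G x) := by
  obtain ⟨hu, hG, ψ, hψ, h1, h2⟩ := h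
  have hlip : ∀ s t, ‖T s - T t‖ ≤ B * ‖s - t‖ := fun s t =>
    Convex.norm_image_sub_le_of_norm_deriv_le (fun x _ => hT.differentiable (by simp) x)
      (fun x _ => hB x) convex_univ (Set.mem_univ t) (Set.mem_univ s)
  have hB0 : 0 ≤ B := (abs_nonneg _).trans (hB 0)
  have hdT : Continuous (deriv T) := hT.continuous_deriv (by simp)
  have hm1 : AEStronglyMeasurable (fun x => T (u x)) volume :=
    hT.continuous.comp_aestronglyMeasurable hu.1
  have hm2 : AEStronglyMeasurable (fun x => deriv T (u x) • G x) volume :=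
    (hdT.comp_aestronglyMeasurable hu.1).smul hG.1
  obtain ⟨s, hs, hae⟩ := (tendstoInMeasure_of_tendsto_eLpNorm one_ne_zero
    (fun k => (hψ k).integrable.1) hu.1 h1).exists_seq_tendsto_ae
  refine ⟨(hu.norm.const_mul B).mono hm1 (Eventually.of_forall fun x => ?_),
    (hG.norm.const_mul B).mono hm2 (Eventually.of_forall fun x => ?_),
    fun k x => T (ψ (s k) x), fun k => ⟨hT.comp (hψ _).contDiff,
      (hψ _).hasCompactSupport.comp_left hT0, ?_⟩, ?_, ?_⟩
  · have := hlip (u x) 0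
    rw [hT0, sub_zero, sub_zero] at this
    exact this.trans (le_abs_self _)
  · rw [norm_smul]
    exact (mul_le_mul_of_nonneg_right (hB _) (norm_nonneg _)).trans (le_abs_self _)
  · refine (closure_mono fun x hx => ?_).trans (hψ (s k)).tsupport_subset
    intro h0
    exact hx (by simp only [h0, hT0])
  · have h3 : Tendsto (fun k => ENNReal.ofReal B *
        eLpNorm (fun x => ψ (s k) x - u x) 1 volume) atTop (𝓝 0) := by
      simpa using ENNReal.Tendsto.const_mul (h1.comp hs.tendsto_atTop)
        (Or.inr ENNReal.ofReal_ne_top)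
    refine tendsto_of_tendsto_of_tendsto_of_le_of_le tendsto_const_nhds h3 (fun _ => zero_le)
      fun k => ?_
    exact eLpNorm_le_mul_eLpNorm_of_ae_le_mul (Eventually.of_forall fun x => hlip _ _) 1
  · have hgrad : ∀ k x, gradient (fun x => T (ψ (s k) x)) x
        = deriv T (ψ (s k) x) • gradient (ψ (s k)) x := by
      intro k x
      have hd : HasFDerivAt (fun x => T (ψ (s k) x))
          (deriv T (ψ (s k) x) • fderiv ℝ (ψ (s k)) x) x :=
        (hT.differentiable (by simp) _).hasDerivAt.comp_hasFDerivAt x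
          ((hψ (s k)).contDiff.differentiable (by simp) x).hasFDerivAt
      rw [gradient, hd.fderiv, map_smulₛₗ]
      rfl
    have hl : Tendsto (fun k => ∫⁻ x, ‖deriv T (ψ (s k) x) - deriv T (u x)‖ₑ * ‖G x‖ₑ) atTop
        (𝓝 (∫⁻ _ : E n, 0)) := by
      refine tendsto_lintegral_of_dominated_convergence'
        (fun x => ENNReal.ofReal (B + B) * ‖G x‖ₑ) (fun k => ?_) (fun k => ?_) ?_ ?_
      · exact ((hdT.comp_aestronglyMeasurable (hψ _).integrable.1).sub
          (hdT.comp_aestronglyMeasurable hu.1)).enorm.mul hG.1.enorm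
      · refine Eventually.of_forall fun x => ?_
        simp only
        gcongr
        rw [← ofReal_norm]
        exact ENNReal.ofReal_le_ofReal ((norm_sub_le _ _).trans (add_le_add (hB _) (hB _)))
      · rw [lintegral_const_mul' _ _ ENNReal.ofReal_ne_top]
        exact ENNReal.mul_ne_top ENNReal.ofReal_ne_top hG.2.ne
      · filter_upwards [hae] with x hx
        have c1 : Tendsto (fun k => ‖deriv T (ψ (s k) x) - deriv T (u x)‖ₑ) atTop (𝓝 0) := by
          have := ((hdT.tendsto (u x)).comp hx).sub_const (deriv T (u x))
          rw [sub_self] at this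
          simpa using this.enorm
        simpa using ENNReal.Tendsto.mul_const c1 (Or.inr enorm_ne_top)
    rw [lintegral_zero] at hl
    have h3 : Tendsto (fun k => ENNReal.ofReal B *
        eLpNorm (fun x => gradient (ψ (s k)) x - G x) 1 volume) atTop (𝓝 0) := by
      simpa using ENNReal.Tendsto.const_mul (h2.comp hs.tendsto_atTop)
        (Or.inr ENNReal.ofReal_ne_top)
    have h4 := h3.add hl
    rw [add_zero] at h4
    refine tendsto_of_tendsto_of_tendsto_of_le_of_le tendsto_const_nhds h4 (fun _ => zero_le)
      fun k => ?_
    simp only [eLpNorm_one_eq_lintegral_enorm, hgrad]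
    rw [← lintegral_const_mul' _ _ ENNReal.ofReal_ne_top]
    have hme : AEMeasurable (fun x => ‖gradient (ψ (s k)) x - G x‖ₑ) volume :=
      ((continuous_gradient (hψ _).contDiff).aestronglyMeasurable.sub hG.1).enorm
    rw [← lintegral_add_left' (hme.const_mul _)]
    refine lintegral_mono fun x => ?_
    have : deriv T (ψ (s k) x) • gradient (ψ (s k)) x - deriv T (u x) • G x
        = deriv T (ψ (s k) x) • (gradient (ψ (s k)) x - G x)
          + (deriv T (ψ (s k) x) - deriv T (u x)) • G x := by
      rw [smul_sub, sub_smul]; abel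
    rw [this]
    refine (enorm_add_le _ _).trans ?_
    rw [enorm_smul, enorm_smul]
    gcongr
    rw [← ofReal_norm]
    exact ENNReal.ofReal_le_ofReal (hB _)

/-- Product rule for `W₀^{1,1}`. -/
theorem mul_left (h : IsSobolevLimit Ω u G) {θ : E n → ℝ} {U : Set (E n)}
    (hθ : IsTestFunction U θ) :
    IsSobolevLimit Ω (fun x => θ x * u x) (fun x => θ x • G x + u x • gradient θ x) := by
  obtain ⟨hu, hG, ψ, hψ, h1, h2⟩ := h
  obtain ⟨A, hA0, hA, hA'⟩ := hθ.exists_bound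
  have hc := hθ.contDiff.continuous
  have hcg := continuous_gradient hθ.contDiff
  have hgrad : ∀ k x, gradient (fun x => θ x * ψ k x) x
      = θ x • gradient (ψ k) x + ψ k x • gradient θ x := by
    intro k x
    have hd : HasFDerivAt (fun x => θ x * ψ k x)
        (θ x • fderiv ℝ (ψ k) x + ψ k x • fderiv ℝ θ x) x :=
      (hθ.contDiff.differentiable (by simp) x).hasFDerivAt.mul
        ((hψ k).contDiff.differentiable (by simp) x).hasFDerivAt
    rw [gradient, hd.fderiv, map_add, map_smulₛₗ, map_smulₛₗ]
    rfl
  have i1 : Integrable (fun x => θ x • G x) := hG.bdd_smul A hc.aestronglyMeasurable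
    (Eventually.of_forall hA)
  have i2 : Integrable (fun x => u x • gradient θ x) := hu.smul_bdd A hcg.aestronglyMeasurable
    (Eventually.of_forall hA')
  refine ⟨hu.bdd_mul hc.aestronglyMeasurable (Eventually.of_forall hA), i1.add i2,
    fun k x => θ x * ψ k x, fun k => ⟨hθ.contDiff.mul (hψ k).contDiff,
      (hψ k).hasCompactSupport.mul_left, ?_⟩, ?_, ?_⟩
  · exact (tsupport_mul_subset_right).trans (hψ k).tsupport_subset
  · have h3 : Tendsto (fun k => ENNReal.ofReal A *
        eLpNorm (fun x => ψ k x - u x) 1 volume) atTop (𝓝 0) := by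
      simpa using ENNReal.Tendsto.const_mul h1 (Or.inr ENNReal.ofReal_ne_top)
    refine tendsto_of_tendsto_of_tendsto_of_le_of_le tendsto_const_nhds h3 (fun _ => zero_le)
      fun k => ?_
    refine eLpNorm_le_mul_eLpNorm_of_ae_le_mul (Eventually.of_forall fun x => ?_) 1
    rw [← mul_sub, norm_mul]
    exact mul_le_mul_of_nonneg_right (hA x) (norm_nonneg _)
  · have h3 : Tendsto (fun k => ENNReal.ofReal A *
        eLpNorm (fun x => gradient (ψ k) x - G x) 1 volume + ENNReal.ofReal A *
        eLpNorm (fun x => ψ k x - u x) 1 volume) atTop (𝓝 0) := by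
      simpa using (ENNReal.Tendsto.const_mul h2 (Or.inr ENNReal.ofReal_ne_top)).add
        (ENNReal.Tendsto.const_mul h1 (Or.inr ENNReal.ofReal_ne_top))
    refine tendsto_of_tendsto_of_tendsto_of_le_of_le tendsto_const_nhds h3 (fun _ => zero_le)
      fun k => ?_
    simp only [eLpNorm_one_eq_lintegral_enorm, hgrad]
    rw [← lintegral_const_mul' _ _ ENNReal.ofReal_ne_top,
      ← lintegral_const_mul' _ _ ENNReal.ofReal_ne_top]
    have hme : AEMeasurable (fun x => ‖gradient (ψ k) x - G x‖ₑ) volume :=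
      ((continuous_gradient (hψ _).contDiff).aestronglyMeasurable.sub hG.1).enorm
    rw [← lintegral_add_left' (hme.const_mul _)]
    refine lintegral_mono fun x => ?_
    have : θ x • gradient (ψ k) x + ψ k x • gradient θ x - (θ x • G x + u x • gradient θ x)
        = θ x • (gradient (ψ k) x - G x) + (ψ k x - u x) • gradient θ x := by
      rw [smul_sub, sub_smul]; abel
    rw [this]
    refine (enorm_add_le _ _).trans ?_
    rw [enorm_smul, enorm_smul, mul_comm ‖ψ k x - u x‖ₑ]
    gcongr
    · rw [← ofReal_norm]
      exact ENNReal.ofReal_le_ofReal (hA _)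
    · rw [← ofReal_norm]
      exact ENNReal.ofReal_le_ofReal (hA' _)

end IsSobolevLimit

/-! ### Gradients of mollifications -/

theorem contDiff_mollify {k : E n → ℝ} (hk : ContDiff ℝ ∞ k) (hk' : HasCompactSupport k)
    {f : E n → ℝ} (hf : LocallyIntegrable f) : ContDiff ℝ ∞ (mollify k f) :=
  hk'.contDiff_convolution_left _ hk hf

theorem gradient_mollify_left {k : E n → ℝ} (hk : ContDiff ℝ ∞ k) (hk' : HasCompactSupport k)
    {f : E n → ℝ} (hf : LocallyIntegrable f) (x : E n) :
    gradient (mollify k f) x = ∫ t, f (x - t) • gradient k t := by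
  have h1 := hk'.hasFDerivAt_convolution_left (ContinuousLinearMap.lsmul ℝ ℝ)
    (hk.of_le (by simp)) hf x
  rw [gradient, mollify, h1.fderiv, convolution_def]
  have h2 : ∀ t, f (x - t) • gradient k t = (InnerProductSpace.toDual ℝ (E n)).symm
      (f (x - t) • fderiv ℝ k t) := fun t => by rw [map_smulₛₗ]; rfl
  simp only [h2]
  rw [← LinearIsometryEquiv.coe_toContinuousLinearEquiv,
    ContinuousLinearEquiv.integral_comp_comm]
  congr 2
  ext t w
  simp [mul_comm]

theorem gradient_mollify_right {k : E n → ℝ} (hk : Continuous k) (hk' : HasCompactSupport k)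
    {ψ : E n → ℝ} (hψ : ContDiff ℝ ∞ ψ) (hψ' : HasCompactSupport ψ) (x : E n) :
    gradient (mollify k ψ) x = mollify k (gradient ψ) x := by
  have h1 := hψ'.hasFDerivAt_convolution_right (μ := volume) (ContinuousLinearMap.lsmul ℝ ℝ)
    (hk.integrable_of_hasCompactSupport hk').locallyIntegrable (hψ.of_le (by simp)) x
  rw [gradient, mollify, h1.fderiv, convolution_def, mollify_apply]
  have h2 : ∀ t, k t • gradient ψ (x - t) = (InnerProductSpace.toDual ℝ (E n)).symm
      (k t • fderiv ℝ ψ (x - t)) := fun t => by rw [map_smulₛₗ]; rfl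
  simp only [h2]
  rw [← LinearIsometryEquiv.coe_toContinuousLinearEquiv,
    ContinuousLinearEquiv.integral_comp_comm]
  congr 2

theorem tendsto_eLpNorm_comp_sub_left {F : Type*} [NormedAddCommGroup F] {f : ℕ → E n → F}
    {g : E n → F} (h : Tendsto (fun j => eLpNorm (fun x => f j x - g x) 1 volume) atTop (𝓝 0))
    (x : E n) :
    Tendsto (fun j => eLpNorm (fun t => f j (x - t) - g (x - t)) 1 volume) atTop (𝓝 0) := by
  refine h.congr fun j => ?_
  simp only [eLpNorm_one_eq_lintegral_enorm]
  exact (lintegral_sub_left_eq_self (fun t => ‖f j t - g t‖ₑ) x).symm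

/-- The gradient of the mollification is the mollification of the weak gradient, on all of `ℝⁿ`
because the extension by zero of a `W₀^{1,1}` function is a Sobolev function. -/
theorem IsSobolevLimit.gradient_mollify {Ω : Set (E n)} {u : E n → ℝ} {G : E n → E n}
    (h : IsSobolevLimit Ω u G) {k : E n → ℝ} (hk : ContDiff ℝ ∞ k) (hk' : HasCompactSupport k)
    (x : E n) : gradient (mollify k u) x = mollify k G x := by
  obtain ⟨hu, hG, ψ, hψ, h1, h2⟩ := h
  obtain ⟨A, -, hA, hA'⟩ := (IsTestFunction.mk hk hk' (Set.subset_univ _)).exists_bound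
  have hcg := continuous_gradient hk
  have t1 : Tendsto (fun j => gradient (mollify k (ψ j)) x) atTop
      (𝓝 (gradient (mollify k u) x)) := by
    rw [gradient_mollify_left hk hk' hu.locallyIntegrable]
    simp only [fun j => gradient_mollify_left hk hk' (hψ j).integrable.locallyIntegrable x]
    refine tendsto_integral_of_norm_sub_le (M := A) (tendsto_eLpNorm_comp_sub_left h1 x)
      (fun j => ((hψ j).integrable.comp_sub_left x).smul_bdd A hcg.aestronglyMeasurable
        (Eventually.of_forall hA'))
      ((hu.comp_sub_left x).smul_bdd A hcg.aestronglyMeasurable (Eventually.of_forall hA')).1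
      fun j t => ?_
    rw [← sub_smul, norm_smul, mul_comm]
    exact mul_le_mul_of_nonneg_right (hA' t) (norm_nonneg _)
  have t2 : Tendsto (fun j => mollify k (gradient (ψ j)) x) atTop (𝓝 (mollify k G x)) := by
    simp only [mollify_apply]
    refine tendsto_integral_of_norm_sub_le (M := A) (tendsto_eLpNorm_comp_sub_left h2 x)
      (fun j => integrable_mollify_integrand hk.continuous hk'
        (hψ j).integrable_gradient.locallyIntegrable x)
      (integrable_mollify_integrand hk.continuous hk' hG.locallyIntegrable x).1
      fun j t => ?_
    rw [← smul_sub, norm_smul]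
    exact mul_le_mul_of_nonneg_right (hA t) (norm_nonneg _)
  refine tendsto_nhds_unique t1 (t2.congr fun j => ?_)
  exact (gradient_mollify_right hk.continuous hk' (hψ j).contDiff (hψ j).hasCompactSupport x).symm

/-! ### The modular of a mollified gradient -/

theorem add_rpow_le_two_rpow_mul {s t r q : ℝ} (hs : 0 ≤ s) (ht : 0 ≤ t) (hr : 0 ≤ r)
    (hrq : r ≤ q) : (s + t) ^ r ≤ 2 ^ q * (s ^ r + t ^ r) := by
  have h1 : (s + t) ^ r ≤ (2 * max s t) ^ r :=
    Real.rpow_le_rpow (by positivity) (by linarith [le_max_left s t, le_max_right s t]) hr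
  have h2 : (max s t) ^ r ≤ s ^ r + t ^ r := by
    have := Real.rpow_nonneg hs r
    have := Real.rpow_nonneg ht r
    rcases max_choice s t with h | h <;> rw [h] <;> linarith
  calc (s + t) ^ r ≤ 2 ^ r * (max s t) ^ r := by
        rwa [Real.mul_rpow (by norm_num) (hs.trans (le_max_left _ _))] at h1
    _ ≤ 2 ^ q * (s ^ r + t ^ r) := by
        gcongr
        norm_num

/-- Quasi-convexity of the double phase integrand. -/
theorem doublePhase_norm_add_le {p q α : ℝ} (hp : 1 < p) (hpq : p < q) (hα : 0 ≤ α)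
    (ξ ζ : E n) :
    ‖ξ + ζ‖ ^ p + α * ‖ξ + ζ‖ ^ q
      ≤ 2 ^ q * ((‖ξ‖ ^ p + α * ‖ξ‖ ^ q) + (‖ζ‖ ^ p + α * ‖ζ‖ ^ q)) := by
  have h1 : ‖ξ + ζ‖ ^ p ≤ 2 ^ q * (‖ξ‖ ^ p + ‖ζ‖ ^ p) :=
    (Real.rpow_le_rpow (norm_nonneg _) (norm_add_le _ _) (by linarith)).trans
      (add_rpow_le_two_rpow_mul (norm_nonneg _) (norm_nonneg _) (by linarith) hpq.le)
  have h2 : ‖ξ + ζ‖ ^ q ≤ 2 ^ q * (‖ξ‖ ^ q + ‖ζ‖ ^ q) :=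
    (Real.rpow_le_rpow (norm_nonneg _) (norm_add_le _ _) (by linarith)).trans
      (add_rpow_le_two_rpow_mul (norm_nonneg _) (norm_nonneg _) (by linarith) le_rfl)
  nlinarith [mul_le_mul_of_nonneg_left h2 hα]

theorem aemeasurable_doublePhase {Ω : Set (E n)} {p q : ℝ} {a : E n → ℝ}
    (ha : AEMeasurable a (volume.restrict Ω)) {ξ : E n → E n}
    (hξ : AEStronglyMeasurable ξ (volume.restrict Ω)) :
    AEMeasurable (fun x => ‖ξ x‖ ^ p + a x * ‖ξ x‖ ^ q) (volume.restrict Ω) :=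
  (hξ.norm.aemeasurable.pow_const p).add (ha.mul (hξ.norm.aemeasurable.pow_const q))

theorem modular_add_le {Ω : Set (E n)} (hΩ : IsOpen Ω) {p q : ℝ} (hp : 1 < p) (hpq : p < q)
    {a : E n → ℝ} (ha : AEMeasurable a (volume.restrict Ω)) (ha0 : ∀ x ∈ Ω, 0 ≤ a x)
    {ξ ζ : E n → E n} (hξ : AEStronglyMeasurable ξ (volume.restrict Ω)) :
    modular Ω p q a (fun x => ξ x + ζ x)
      ≤ ENNReal.ofReal (2 ^ q) * (modular Ω p q a ξ + modular Ω p q a ζ) := by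
  unfold modular
  rw [← lintegral_add_left' (aemeasurable_doublePhase ha hξ).ennreal_ofReal,
    ← lintegral_const_mul' _ _ ENNReal.ofReal_ne_top]
  refine setLIntegral_mono' hΩ.measurableSet fun x hx => ?_
  have := ha0 x hx
  rw [← ENNReal.ofReal_add (by positivity) (by positivity), ← ENNReal.ofReal_mul (by positivity)]
  exact ENNReal.ofReal_le_ofReal (doublePhase_norm_add_le hp hpq this _ _)

theorem modular_congr {Ω : Set (E n)} {p q : ℝ} {a : E n → ℝ} {ξ ζ : E n → E n}
    (h : ξ =ᵐ[volume.restrict Ω] ζ) : modular Ω p q a ξ = modular Ω p q a ζ :=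
  lintegral_congr_ae (h.mono fun x hx => by simp only [hx])

/-- Jensen's inequality for mollification. -/
theorem enorm_mollify_rpow_le {k : E n → ℝ} (hkm : Measurable k) (hk0 : ∀ x, 0 ≤ k x)
    (hk1 : ∫⁻ x, ENNReal.ofReal (k x) = 1) {G : E n → E n} (hG : AEStronglyMeasurable G volume)
    {r : ℝ} (hr : 1 ≤ r) (x : E n) :
    ‖mollify k G x‖ₑ ^ r ≤ ∫⁻ t, ENNReal.ofReal (k t) * ‖G (x - t)‖ₑ ^ r := by
  set ν : Measure (E n) := volume.withDensity (fun t => ENNReal.ofReal (k t)) with hν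
  have hprob : IsProbabilityMeasure ν := ⟨by
    rw [hν, withDensity_apply _ MeasurableSet.univ, Measure.restrict_univ, hk1]⟩
  have hint : ∀ f : E n → ℝ≥0∞, ∫⁻ t, f t ∂ν = ∫⁻ t, ENNReal.ofReal (k t) * f t := fun f => by
    rw [hν, lintegral_withDensity_eq_lintegral_mul_non_measurable _ hkm.ennreal_ofReal
      (Eventually.of_forall fun t => ENNReal.ofReal_lt_top)]
    rfl
  have hGx : AEStronglyMeasurable (fun t => G (x - t)) ν :=
    (hG.comp_quasiMeasurePreserving
      (quasiMeasurePreserving_sub_left volume x)).mono_ac (withDensity_absolutelyContinuous _ _)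
  have h1 : ‖mollify k G x‖ₑ ≤ ∫⁻ t, ‖G (x - t)‖ₑ ∂ν := by
    rw [hint, mollify_apply]
    refine (enorm_integral_le_lintegral_enorm _).trans (le_of_eq (lintegral_congr fun t => ?_))
    rw [enorm_smul, Real.enorm_of_nonneg (hk0 t)]
  have h2 := eLpNorm'_le_eLpNorm'_of_exponent_le zero_lt_one hr ν hGx
  simp only [eLpNorm'_eq_lintegral_enorm, ENNReal.rpow_one, div_one] at h2
  rw [← hint]
  calc ‖mollify k G x‖ₑ ^ r ≤ ((∫⁻ t, ‖G (x - t)‖ₑ ^ r ∂ν) ^ (1 / r)) ^ r :=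
        ENNReal.rpow_le_rpow (h1.trans h2) (by linarith)
    _ = _ := by rw [← ENNReal.rpow_mul, one_div_mul_cancel (by linarith), ENNReal.rpow_one]

/-- Jensen's inequality with a weight which bounds the constant `b` from above on the part of
the domain seen by the kernel. -/
theorem mul_norm_mollify_rpow_le {k : E n → ℝ} (hkm : Measurable k) (hk0 : ∀ x, 0 ≤ k x)
    (hk1 : ∫⁻ x, ENNReal.ofReal (k x) = 1) {G : E n → E n} (hG : AEStronglyMeasurable G volume)
    {r : ℝ} (hr : 1 ≤ r) (x : E n) {b : ℝ} (hb : 0 ≤ b) {h : E n → ℝ}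
    (hint : Integrable (fun t => k t • h (x - t))) (hh : ∀ y, 0 ≤ h y)
    (hbh : ∀ t, k t ≠ 0 → b * ‖G (x - t)‖ ^ r ≤ h (x - t)) :
    b * ‖mollify k G x‖ ^ r ≤ mollify k h x := by
  have hm0 : 0 ≤ mollify k h x := integral_nonneg fun t => mul_nonneg (hk0 t) (hh _)
  rw [← ENNReal.ofReal_le_ofReal_iff hm0]
  have h1 := enorm_mollify_rpow_le hkm hk0 hk1 hG hr x
  have hr0 : 0 ≤ r := by linarith
  rw [ENNReal.ofReal_mul hb, ← ENNReal.ofReal_rpow_of_nonneg (norm_nonneg _) hr0,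
    ofReal_norm, mollify_apply k h,
    ofReal_integral_eq_lintegral_ofReal hint (Eventually.of_forall fun t =>
      mul_nonneg (hk0 t) (hh _))]
  refine (mul_le_mul_right h1 _).trans ?_
  rw [← lintegral_const_mul' _ _ ENNReal.ofReal_ne_top]
  refine lintegral_mono fun t => ?_
  by_cases ht : k t = 0
  · simp [ht]
  simp only [smul_eq_mul]
  rw [mul_left_comm, ENNReal.ofReal_mul (hk0 t), ← ofReal_norm,
    ENNReal.ofReal_rpow_of_nonneg (norm_nonneg _) hr0, ← ENNReal.ofReal_mul hb]
  gcongr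
  exact hbh t ht

/-- The key pointwise estimate. The weight at `x` is compared with the weight at the points seen by
the kernel; the error `ρ ^ ϰ` is absorbed by the bound `D` on the mollified gradient, since
`D ^ (q - p)` is all that separates the two phases. -/
theorem doublePhase_mollify_le {Ω : Set (E n)} {p q ϰ ρ C D : ℝ} {a : E n → ℝ} (hp : 1 < p)
    (hpq : p < q) (hϰ : 0 < ϰ) (ha0 : ∀ x ∈ Ω, 0 ≤ a x) (hC : 0 < C)
    (hZ : ∀ x ∈ Ω, ∀ y ∈ Ω, a x ≤ C * (a y + ‖x - y‖ ^ ϰ))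
    {k : E n → ℝ} (hkm : Measurable k) (hk0 : ∀ x, 0 ≤ k x)
    (hk1 : ∫⁻ x, ENNReal.ofReal (k x) = 1) (hρ : ∀ t, k t ≠ 0 → ‖t‖ ≤ ρ) (hρ0 : 0 ≤ ρ)
    {G : E n → E n} (hG : AEStronglyMeasurable G volume) (hG0 : ∀ x ∉ Ω, G x = 0)
    {x : E n} (hx : x ∈ Ω) {h : E n → ℝ}
    (hh : h = Ω.indicator fun y => ‖G y‖ ^ p + a y * ‖G y‖ ^ q)
    (hint : Integrable (fun t => k t • h (x - t))) (hD : ‖mollify k G x‖ ≤ D) :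
    ‖mollify k G x‖ ^ p + a x * ‖mollify k G x‖ ^ q
      ≤ (1 + C + C * (ρ ^ ϰ * D ^ (q - p))) * mollify k h x := by
  have hh0 : ∀ y, 0 ≤ h y := fun y => by
    rw [hh]
    refine Set.indicator_nonneg (fun y hy => ?_) y
    have := ha0 y hy
    positivity
  have hG' : ∀ y, y ∉ Ω → ∀ r : ℝ, 1 ≤ r → ‖G y‖ ^ r = 0 := fun y hy r hr => by
    rw [hG0 y hy, norm_zero, Real.zero_rpow (by linarith)]
  have hP : ‖mollify k G x‖ ^ p ≤ mollify k h x := by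
    have := mul_norm_mollify_rpow_le hkm hk0 hk1 hG hp.le x zero_le_one hint hh0 fun t _ => by
      by_cases hy : x - t ∈ Ω
      · have := ha0 _ hy
        rw [hh, Set.indicator_of_mem hy, one_mul]
        exact le_add_of_nonneg_right (by positivity)
      · rw [hG' _ hy _ hp.le, mul_zero]
        exact hh0 _
    rwa [one_mul] at this
  set b := max (a x / C - ρ ^ ϰ) 0 with hb
  have hb0 : 0 ≤ b := le_max_right _ _
  have hab : a x ≤ C * (b + ρ ^ ϰ) := by
    have h1 : a x / C ≤ b + ρ ^ ϰ := by linarith [le_max_left (a x / C - ρ ^ ϰ) 0]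
    rw [div_le_iff₀ hC] at h1
    linarith
  have hQ : b * ‖mollify k G x‖ ^ q ≤ mollify k h x := by
    refine mul_norm_mollify_rpow_le hkm hk0 hk1 hG (hp.trans hpq).le x hb0 hint hh0 fun t ht => ?_
    by_cases hy : x - t ∈ Ω
    · have h0 := ha0 _ hy
      have h1 : b ≤ a (x - t) := by
        refine max_le ?_ h0
        have h2 := hZ x hx _ hy
        rw [sub_sub_cancel] at h2
        have h3 : ‖t‖ ^ ϰ ≤ ρ ^ ϰ := Real.rpow_le_rpow (norm_nonneg _) (hρ t ht) hϰ.le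
        rw [sub_le_iff_le_add, div_le_iff₀ hC, mul_comm]
        exact h2.trans (by gcongr)
      rw [hh, Set.indicator_of_mem hy]
      have : b * ‖G (x - t)‖ ^ q ≤ a (x - t) * ‖G (x - t)‖ ^ q := by gcongr
      exact this.trans (le_add_of_nonneg_left (by positivity))
    · rw [hG' _ hy _ (hp.trans hpq).le, mul_zero]
      exact hh0 _
  set g := ‖mollify k G x‖ with hg
  have hg0 : 0 ≤ g := norm_nonneg _
  have hgq : g ^ q ≤ D ^ (q - p) * g ^ p := by
    have h1 : g ^ q = g ^ (q - p) * g ^ p := by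
      rw [← Real.rpow_add_of_nonneg hg0 (by linarith) (by linarith)]
      ring_nf
    rw [h1]
    gcongr
  have hρϰ : 0 ≤ ρ ^ ϰ := Real.rpow_nonneg hρ0 _
  have hDq : 0 ≤ D ^ (q - p) := Real.rpow_nonneg (hg0.trans hD) _
  calc g ^ p + a x * g ^ q ≤ g ^ p + C * (b + ρ ^ ϰ) * g ^ q := by gcongr
    _ = g ^ p + C * (b * g ^ q) + C * (ρ ^ ϰ * g ^ q) := by ring
    _ ≤ mollify k h x + C * mollify k h x
        + C * (ρ ^ ϰ * (D ^ (q - p) * mollify k h x)) := by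
        have : D ^ (q - p) * g ^ p ≤ D ^ (q - p) * mollify k h x := by gcongr
        have := hgq.trans this
        gcongr
    _ = _ := by ring

/-- A mollified `γ`-Hölder function has gradient at most `δ ^ (γ - 1)`; for `γ = 0`, the Hölder
condition is boundedness. -/
theorem IsMollifierSeq.norm_gradient_mollify_le {k : ℕ → E n → ℝ} {δ : ℕ → ℝ} {e : E n}
    {η C : ℝ} (hk : IsMollifierSeq k δ e η C) (hη : 0 < η) {w : E n → ℝ} (hw : Integrable w)
    {γ H : ℝ} (hγ : 0 ≤ γ) (hH0 : 0 ≤ H) (hH : ∀ x y, |w x - w y| ≤ H * ‖x - y‖ ^ γ) (j : ℕ)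
    (x : E n) :
    ‖gradient (mollify (k j) w) x‖ ≤ H * (δ j * (‖e‖ + η)) ^ γ * (C / δ j) := by
  have hkc := hk.contDiff j
  have hks := hk.hasCompactSupport j
  have hgi : Integrable (gradient (k j)) :=
    (continuous_gradient hkc).integrable_of_hasCompactSupport (hasCompactSupport_gradient hks)
  have hzero : ∫ t, gradient (k j) t = 0 := by
    have h1 := gradient_mollify_left hkc hks (f := fun _ => (1 : ℝ))
      continuous_const.locallyIntegrable x
    have h2 : mollify (k j) (fun _ => (1 : ℝ)) = fun _ => 1 := by
      ext y
      simp [mollify_apply, hk.integral_eq]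
    rw [h2] at h1
    simp only [one_smul] at h1
    rw [← h1, gradient, fderiv_const_apply, map_zero]
  have hwi : Integrable (fun t => w (x - t) • gradient (k j) t) := by
    obtain ⟨A, -, -, hA'⟩ := (IsTestFunction.mk hkc hks (Set.subset_univ _)).exists_bound
    exact (hw.comp_sub_left x).smul_bdd A (continuous_gradient hkc).aestronglyMeasurable
      (Eventually.of_forall hA')
  have h1 : gradient (mollify (k j) w) x = ∫ t, (w (x - t) - w x) • gradient (k j) t := by
    rw [gradient_mollify_left hkc hks hw.locallyIntegrable]
    simp only [sub_smul]
    rw [integral_sub hwi (hgi.fun_smul (w x)), integral_smul, hzero, smul_zero, sub_zero]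
  rw [h1]
  have hR : 0 ≤ δ j * (‖e‖ + η) := mul_nonneg (hk.pos j).le (by positivity)
  calc ‖∫ t, (w (x - t) - w x) • gradient (k j) t‖
      ≤ ∫ t, (H * (δ j * (‖e‖ + η)) ^ γ) * ‖gradient (k j) t‖ := by
        refine norm_integral_le_of_norm_le (hgi.norm.const_mul _)
          (Eventually.of_forall fun t => ?_)
        rw [norm_smul]
        by_cases ht : t ∈ tsupport (k j)
        · gcongr
          refine (hH _ _).trans ?_
          gcongr
          rw [sub_sub_cancel_left, norm_neg]
          exact hk.norm_le ht
        · rw [gradient_eq_zero_of_notMem_tsupport ht]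
          simp
    _ = H * (δ j * (‖e‖ + η)) ^ γ * ∫ t, ‖fderiv ℝ (k j) t‖ := by
        rw [integral_const_mul]
        simp only [norm_gradient]
    _ ≤ _ := by
        gcongr
        exact hk.integral_fderiv_le j

/-- Modular convergence of the gradients of mollifications of a bounded (`γ = 0`) or `γ`-Hölder
function, in the range of exponents `(q - p) (1 - γ) ≤ ϰ`. -/
theorem IsMollifierSeq.tendsto_modular {Ω : Set (E n)} (hΩ : IsOpen Ω) {p q ϰ : ℝ} {a : E n → ℝ}
    (hp : 1 < p) (hpq : p < q) (hϰ : 0 < ϰ) (ha : AEMeasurable a (volume.restrict Ω))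
    (hZ : MemZ Ω ϰ a) {γ H : ℝ} (hγ0 : 0 ≤ γ) (hγ : (q - p) * (1 - γ) ≤ ϰ) {w : E n → ℝ}
    {G : E n → E n} (hw : IsSobolevLimit Ω w G) (hG0 : ∀ x ∉ Ω, G x = 0) (hH0 : 0 ≤ H)
    (hH : ∀ x y, |w x - w y| ≤ H * ‖x - y‖ ^ γ) (hmod : modular Ω p q a G < ⊤)
    {k : ℕ → E n → ℝ} {δ : ℕ → ℝ} {e : E n} {η C : ℝ} (hk : IsMollifierSeq k δ e η C)
    (hη : 0 < η) (hδ : ∀ j, δ j ≤ 1) :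
    Tendsto (fun j => modular Ω p q a fun x => gradient (mollify (k j) w) x - G x) atTop
      (𝓝 0) := by
  obtain ⟨ha0, A, hA, hZ⟩ := hZ
  have hC0 : 0 ≤ C := by
    have := (integral_nonneg (fun _ => norm_nonneg _)).trans (hk.integral_fderiv_le 0)
    by_contra hneg
    exact absurd (div_neg_of_neg_of_pos (not_le.1 hneg) (hk.pos 0)) (not_lt.2 this)
  set h : E n → ℝ := Ω.indicator fun y => ‖G y‖ ^ p + a y * ‖G y‖ ^ q with hh
  have hh0 : ∀ y, 0 ≤ h y := fun y => by
    refine Set.indicator_nonneg (fun y hy => ?_) y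
    have := ha0 y hy
    positivity
  have hhm := aemeasurable_doublePhase (p := p) (q := q) ha hw.integrable_grad.1.restrict
  have hhi : Integrable h := by
    rw [hh, integrable_indicator_iff hΩ.measurableSet]
    refine ⟨hhm.aestronglyMeasurable, ?_⟩
    rw [hasFiniteIntegral_iff_ofReal ((ae_restrict_iff' hΩ.measurableSet).2
      (Eventually.of_forall fun y hy => ?_))]
    · exact hmod
    · have := ha0 y hy
      simp only [Pi.zero_apply]
      positivity
  set R := ‖e‖ + η with hR
  have hR0 : 0 ≤ R := by positivity
  set B := R ^ ϰ * (H * R ^ γ * C) ^ (q - p) with hB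
  have hB0 : 0 ≤ B := by positivity
  -- the total power of `δ j` is `ϰ - (q - p) (1 - γ) ≥ 0`, and `δ j ≤ 1`
  have hscale : ∀ j, (δ j * R) ^ ϰ * (H * (δ j * R) ^ γ * (C / δ j)) ^ (q - p) ≤ B := by
    intro j
    have hj := hk.pos j
    have e1 : H * (δ j * R) ^ γ * (C / δ j) = δ j ^ (γ - 1) * (H * R ^ γ * C) := by
      rw [Real.mul_rpow hj.le hR0, Real.rpow_sub_one hj.ne']
      ring
    rw [e1, Real.mul_rpow hj.le hR0, Real.mul_rpow (by positivity) (by positivity),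
      ← Real.rpow_mul hj.le]
    have e2 : δ j ^ ϰ * δ j ^ ((γ - 1) * (q - p)) ≤ 1 := by
      rw [← Real.rpow_add hj]
      exact Real.rpow_le_one hj.le (hδ j) (by nlinarith)
    calc _ = (δ j ^ ϰ * δ j ^ ((γ - 1) * (q - p))) * B := by rw [hB]; ring
      _ ≤ 1 * B := by gcongr
      _ = B := one_mul B
  set K := 1 + A + A * B with hK
  have hK0 : 0 ≤ K := by positivity
  have hpt : ∀ j, ∀ x ∈ Ω, ‖gradient (mollify (k j) w) x‖ ^ p
      + a x * ‖gradient (mollify (k j) w) x‖ ^ q ≤ K * mollify (k j) h x := by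
    intro j x hx
    have hint := integrable_mollify_integrand (hk.contDiff j).continuous (hk.hasCompactSupport j)
      hhi.locallyIntegrable x
    have hD := hk.norm_gradient_mollify_le hη hw.integrable hγ0 hH0 hH j x
    rw [hw.gradient_mollify (hk.contDiff j) (hk.hasCompactSupport j)] at hD ⊢
    refine (doublePhase_mollify_le hp hpq hϰ ha0 hA hZ (hk.contDiff j).continuous.measurable
      (hk.nonneg j) (hk.lintegral_eq j) (fun t ht => hk.norm_le (subset_tsupport _ ht))
      (mul_nonneg (hk.pos j).le hR0) hw.integrable_grad.1 hG0 hx hh hint hD).trans ?_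
    have : 0 ≤ mollify (k j) h x := integral_nonneg fun t => mul_nonneg (hk.nonneg j t) (hh0 _)
    have h1 := hscale j
    rw [hK]
    gcongr
  set L := ENNReal.ofReal (2 ^ q * (K + 1)) with hL
  have hLt : L ≠ ⊤ := ENNReal.ofReal_ne_top
  have hgm : ∀ j, AEStronglyMeasurable (gradient (mollify (k j) w)) volume := fun j =>
    (continuous_gradient (contDiff_mollify (hk.contDiff j) (hk.hasCompactSupport j)
      hw.integrable.locallyIntegrable)).aestronglyMeasurable
  have hmm : ∀ j, AEStronglyMeasurable (mollify (k j) h) volume := fun j =>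
    (continuous_mollify (hk.contDiff j).continuous (hk.hasCompactSupport j)
      hhi.locallyIntegrable).aestronglyMeasurable
  have hdom : ∀ j, ∀ x ∈ Ω, ENNReal.ofReal (‖gradient (mollify (k j) w) x - G x‖ ^ p
      + a x * ‖gradient (mollify (k j) w) x - G x‖ ^ q)
      ≤ L * ‖mollify (k j) h x - h x‖ₑ + L * ENNReal.ofReal (h x) := by
    intro j x hx
    have h1 := doublePhase_norm_add_le hp hpq (ha0 x hx) (gradient (mollify (k j) w) x) (-G x)
    rw [norm_neg, ← sub_eq_add_neg] at h1
    have h2 : h x = ‖G x‖ ^ p + a x * ‖G x‖ ^ q := by rw [hh, Set.indicator_of_mem hx]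
    rw [← h2] at h1
    have h3 := hpt j x hx
    rw [← mul_add, ← ofReal_norm, ← ENNReal.ofReal_add (norm_nonneg _) (hh0 x), hL,
      ← ENNReal.ofReal_mul (by positivity)]
    refine ENNReal.ofReal_le_ofReal (h1.trans ?_)
    rw [mul_assoc]
    gcongr
    have h4 : mollify (k j) h x ≤ ‖mollify (k j) h x - h x‖ + h x := by
      have := le_abs_self (mollify (k j) h x - h x)
      rw [Real.norm_eq_abs]
      linarith
    have h5 : K * mollify (k j) h x ≤ K * (‖mollify (k j) h x - h x‖ + h x) := by gcongr
    have := norm_nonneg (mollify (k j) h x - h x)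
    linarith
  have hGL1 := hk.tendsto_eLpNorm_mollify_sub hw.integrable_grad
  have hhL1 := hk.tendsto_eLpNorm_mollify_sub hhi
  -- Along subsequences, `f ≤ L e + L h` with `e → 0` in `L¹` is used as `f ≤ L e + min f (L h)`,
  -- whose second term is dominated by a fixed integrable function.
  refine tendsto_of_subseq_tendsto fun s hs => ?_
  obtain ⟨s', hs', hae⟩ := (tendstoInMeasure_of_tendsto_eLpNorm one_ne_zero
    (fun j => hgm (s j)) hw.integrable_grad.1 ((hGL1.comp hs).congr fun j => by
      simp only [Function.comp_apply]
      congr 1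
      ext1 x
      rw [Pi.sub_apply,
        hw.gradient_mollify (hk.contDiff _) (hk.hasCompactSupport _)])).exists_seq_tendsto_ae
  refine ⟨s', ?_⟩
  have t1 : Tendsto (fun j => L * ∫⁻ x in Ω, ‖mollify (k (s (s' j))) h x - h x‖ₑ) atTop
      (𝓝 0) := by
    have := ENNReal.Tendsto.const_mul (a := L) (hhL1.comp (hs.comp hs'.tendsto_atTop))
      (Or.inr hLt)
    rw [mul_zero] at this
    refine tendsto_of_tendsto_of_tendsto_of_le_of_le tendsto_const_nhds this (fun _ => zero_le)
      fun j => ?_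
    simp only [Function.comp_apply, eLpNorm_one_eq_lintegral_enorm]
    gcongr
    exact Measure.restrict_le_self
  have t2 : Tendsto (fun j => ∫⁻ x in Ω, min (ENNReal.ofReal
      (‖gradient (mollify (k (s (s' j))) w) x - G x‖ ^ p
        + a x * ‖gradient (mollify (k (s (s' j))) w) x - G x‖ ^ q)) (L * ENNReal.ofReal (h x)))
      atTop (𝓝 (∫⁻ _ in Ω, 0)) := by
    refine tendsto_lintegral_of_dominated_convergence' (fun x => L * ENNReal.ofReal (h x))
      (fun j => ?_) (fun j => ?_) ?_ ?_
    · exact (aemeasurable_doublePhase ha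
        ((hgm _).sub hw.integrable_grad.1).restrict).ennreal_ofReal.min
        (hhi.1.aemeasurable.restrict.ennreal_ofReal.const_mul _)
    · exact Eventually.of_forall fun x => min_le_right _ _
    · rw [lintegral_const_mul' _ _ hLt]
      refine ENNReal.mul_ne_top hLt (ne_top_of_le_ne_top ?_
        (lintegral_mono' Measure.restrict_le_self le_rfl))
      exact ((hasFiniteIntegral_iff_ofReal (Eventually.of_forall hh0)).1 hhi.2).ne
    · refine ae_restrict_of_ae (hae.mono fun x hx => ?_)
      have c1 : Tendsto (fun j => ‖gradient (mollify (k (s (s' j))) w) x - G x‖) atTop (𝓝 0) :=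
        tendsto_iff_norm_sub_tendsto_zero.1 hx
      have c2 := (c1.rpow_const (p := p) (Or.inr (by linarith))).add
        ((c1.rpow_const (p := q) (Or.inr (by linarith))).const_mul (a x))
      rw [Real.zero_rpow (by linarith), Real.zero_rpow (by linarith), mul_zero, add_zero] at c2
      have c3 := ENNReal.tendsto_ofReal c2
      rw [ENNReal.ofReal_zero] at c3
      exact tendsto_of_tendsto_of_tendsto_of_le_of_le tendsto_const_nhds c3
        (fun _ => zero_le) fun _ => min_le_left _ _
  rw [lintegral_zero] at t2
  have t3 := t1.add t2
  rw [add_zero] at t3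
  refine tendsto_of_tendsto_of_tendsto_of_le_of_le tendsto_const_nhds t3 (fun _ => zero_le)
    fun j => ?_
  simp only [modular]
  have hme : AEMeasurable (fun x => ‖mollify (k (s (s' j))) h x - h x‖ₑ) (volume.restrict Ω) :=
    ((hmm _).sub hhi.1).enorm.restrict
  rw [← lintegral_const_mul' _ _ hLt, ← lintegral_add_left' (hme.const_mul _)]
  refine setLIntegral_mono' hΩ.measurableSet fun x hx => ?_
  rcases min_choice (ENNReal.ofReal (‖gradient (mollify (k (s (s' j))) w) x - G x‖ ^ p
    + a x * ‖gradient (mollify (k (s (s' j))) w) x - G x‖ ^ q)) (L * ENNReal.ofReal (h x))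
    with hmin | hmin <;> rw [hmin]
  · exact le_add_self
  · exact hdom _ x hx

/-! ### Lipschitz boundaries -/

theorem norm_sub_inner_smul_le {e : E n} (he : ‖e‖ = 1) (v : E n) :
    ‖v - inner ℝ e v • e‖ ≤ ‖v‖ := by
  refine le_of_sq_le_sq ?_ (norm_nonneg _)
  rw [norm_sub_sq_real, inner_smul_right, norm_smul, he, real_inner_comm e v, mul_one,
    Real.norm_eq_abs, sq_abs]
  nlinarith [sq_nonneg (inner ℝ e v)]

namespace IsBoundedLipschitzDomain

variable {Ω : Set (E n)}

/-- Every point of the closure has a neighbourhood whose part in the closure is moved into the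
domain by all small displacements in a cone around some direction `e`. At boundary points, the
cone is steeper than the Lipschitz constant of the graph. -/
theorem exists_inward_cone (hΩ : IsBoundedLipschitzDomain Ω) {x : E n} (hx : x ∈ closure Ω) :
    ∃ (r : ℝ) (e : E n) (η d : ℝ), 0 < r ∧ 0 < η ∧ 0 < d ∧
      ∀ y ∈ ball x r, y ∈ closure Ω → ∀ z ∈ closedBall e η, ∀ t, 0 < t → t < d →
        y + t • z ∈ Ω := by
  by_cases hxΩ : x ∈ Ω
  · obtain ⟨r, hr, hball⟩ := Metric.isOpen_iff.1 hΩ.isOpen x hxΩ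
    refine ⟨r / 2, 0, 1, r / 2, by positivity, one_pos, by positivity,
      fun y hy _ z hz t ht0 ht => hball ?_⟩
    rw [mem_closedBall, dist_zero_right] at hz
    rw [mem_ball, dist_eq_norm] at hy ⊢
    calc ‖y + t • z - x‖ = ‖(y - x) + t • z‖ := by congr 1; abel
      _ ≤ ‖y - x‖ + t * ‖z‖ := (norm_add_le _ _).trans (by
          rw [norm_smul, Real.norm_of_nonneg ht0.le])
      _ < r := by nlinarith
  obtain ⟨r, e, K, g, hr, he, hg, hgr⟩ := hΩ.lipschitz_boundary x
    (by rw [hΩ.isOpen.frontier_eq]; exact ⟨hx, hxΩ⟩)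
  have hK : (0 : ℝ) ≤ K := K.2
  refine ⟨r / 2, e, 1 / (K + 2), r / 4, by positivity, by positivity, by positivity,
    fun y hy hyc z hz t ht0 ht => ?_⟩
  set η : ℝ := 1 / (K + 2) with hη
  have hη0 : 0 < η := by positivity
  have hη1 : (K + 2) * η = 1 := by rw [hη]; field_simp
  rw [mem_closedBall, dist_eq_norm] at hz
  have hzn : ‖z‖ ≤ 2 := by
    calc ‖z‖ = ‖(z - e) + e‖ := by simp
      _ ≤ η + 1 := (norm_add_le _ _).trans (by rw [he]; gcongr)
      _ ≤ 2 := by nlinarith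
  have hgy : g (y - inner ℝ e y • e) ≤ inner ℝ e y := by
    have hcl : IsClosed {y : E n | g (y - inner ℝ e y • e) ≤ inner ℝ e y} :=
      isClosed_le (hg.continuous.comp (by fun_prop)) (by fun_prop)
    have hsub : ball x r ∩ Ω ⊆ {y : E n | g (y - inner ℝ e y • e) ≤ inner ℝ e y} :=
      fun w hw => ((hgr w hw.1).1 hw.2).le
    exact closure_minimal hsub hcl
      (isOpen_ball.inter_closure ⟨ball_subset_ball (by linarith) hy, hyc⟩)
  have hball : y + t • z ∈ ball x r := by
    rw [mem_ball, dist_eq_norm] at hy ⊢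
    calc ‖y + t • z - x‖ = ‖(y - x) + t • z‖ := by congr 1; abel
      _ ≤ ‖y - x‖ + t * ‖z‖ := (norm_add_le _ _).trans (by
          rw [norm_smul, Real.norm_of_nonneg ht0.le])
      _ < r := by nlinarith
  rw [hgr _ hball]
  have hee : inner ℝ e e = (1 : ℝ) := by rw [real_inner_self_eq_norm_sq, he, one_pow]
  have hez : 1 - η ≤ inner ℝ e z := by
    have h1 : inner ℝ e z = 1 + inner ℝ e (z - e) := by rw [inner_sub_right, hee]; ring
    have h2 := abs_real_inner_le_norm e (z - e)
    rw [he, one_mul] at h2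
    have h3 := abs_le.1 (h2.trans hz)
    rw [h1]
    linarith [h3.1]
  have hproj : ‖z - inner ℝ e z • e‖ ≤ η := by
    have h1 : z - inner ℝ e z • e = (z - e) - inner ℝ e (z - e) • e := by
      rw [inner_sub_right, hee, sub_smul, one_smul]; abel
    rw [h1]
    exact (norm_sub_inner_smul_le he _).trans hz
  have h1 : y + t • z - inner ℝ e (y + t • z) • e
      = (y - inner ℝ e y • e) + t • (z - inner ℝ e z • e) := by
    rw [inner_add_right, inner_smul_right, add_smul, mul_smul, smul_sub]; abel
  have h2 := hg.dist_le_mul (y + t • z - inner ℝ e (y + t • z) • e) (y - inner ℝ e y • e)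
  rw [h1, dist_eq_norm (_ + _), add_sub_cancel_left, norm_smul, Real.norm_of_nonneg ht0.le,
    Real.dist_eq] at h2
  have h3 := (le_abs_self _).trans h2
  rw [h1, inner_add_right, inner_smul_right]
  have h4 : (K : ℝ) * (t * ‖z - inner ℝ e z • e‖) ≤ K * (t * η) := by gcongr
  nlinarith

/-- The complement of the domain has interior points near every boundary point. -/
theorem exists_ball_disjoint (hΩ : IsBoundedLipschitzDomain Ω) {z : E n} (hz : z ∈ frontier Ω)
    {r : ℝ} (hr : 0 < r) :
    ∃ x ∈ ball z r, ∃ ρ > 0, ∀ y ∈ ball x ρ, y ∉ Ω := by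
  obtain ⟨R, e, K, g, hR, he, hg, hgr⟩ := hΩ.lipschitz_boundary z hz
  set t := min r R / 2 with ht
  have hm : 0 < min r R := lt_min hr hR
  have ht0 : 0 < t := by positivity
  have htr : t < min r R := by linarith
  have hnorm : ‖t • e‖ = t := by rw [norm_smul, he, mul_one, Real.norm_of_nonneg ht0.le]
  have hmem : ∀ s, t < s → z - t • e ∈ ball z s := fun s hs => by
    rw [mem_ball, dist_eq_norm, sub_sub_cancel_left, norm_neg, hnorm]
    exact hs
  have hzΩ : z ∉ Ω := by
    rw [hΩ.isOpen.frontier_eq] at hz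
    exact hz.2
  have hgz : inner ℝ e z ≤ g (z - inner ℝ e z • e) := by
    by_contra h
    exact hzΩ ((hgr z (mem_ball_self hR)).2 (not_le.1 h))
  have hee : inner ℝ e e = (1 : ℝ) := by rw [real_inner_self_eq_norm_sq, he, one_pow]
  have hopen : IsOpen (ball z R ∩ {y : E n | inner ℝ e y < g (y - inner ℝ e y • e)}) :=
    isOpen_ball.inter (isOpen_lt (by fun_prop) (hg.continuous.comp (by fun_prop)))
  have hx : z - t • e ∈ ball z R ∩ {y : E n | inner ℝ e y < g (y - inner ℝ e y • e)} := by
    refine ⟨hmem R (htr.trans_le (min_le_right _ _)), ?_⟩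
    have h1 : z - t • e - inner ℝ e (z - t • e) • e = z - inner ℝ e z • e := by
      rw [inner_sub_right, inner_smul_right, hee, mul_one, sub_smul]; abel
    rw [Set.mem_ofPred_eq, h1, inner_sub_right, inner_smul_right, hee]
    linarith
  obtain ⟨ρ, hρ, hball⟩ := Metric.isOpen_iff.1 hopen _ hx
  refine ⟨z - t • e, hmem r (htr.trans_le (min_le_left _ _)), ρ, hρ, fun y hy hyΩ => ?_⟩
  have := hball hy
  exact lt_asymm this.2 ((hgr y this.1).1 hyΩ)

end IsBoundedLipschitzDomain

theorem IsMollifierSeq.mollify_eq_of_eqOn {k : ℕ → E n → ℝ} {δ : ℕ → ℝ} {e : E n} {η C : ℝ}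
    (hk : IsMollifierSeq k δ e η C) {F : Type*} [NormedAddCommGroup F] [NormedSpace ℝ F]
    [CompleteSpace F] {f : E n → F} {x : E n} {c : F} {j : ℕ} {ρ : ℝ} (hj : δ j * (‖e‖ + η) < ρ)
    (hf : ∀ y ∈ ball x ρ, f y = c) : mollify (k j) f x = c := by
  have : ∀ t, k j t • f (x - t) = k j t • c := fun t => by
    by_cases ht : k j t = 0
    · simp [ht]
    · rw [hf]
      rw [mem_ball, dist_eq_norm, sub_sub_cancel_left, norm_neg]
      exact (hk.norm_le (subset_tsupport _ ht)).trans_lt hj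
  rw [mollify_apply]
  simp only [this]
  rw [integral_smul_const, hk.integral_eq, one_smul]

/-- A function in `W₀^{1,1}(Ω)` cannot stay away from zero near a boundary point: otherwise the
indicator function of `Ω`, a smooth function of it there, would have zero gradient across the
boundary. -/
theorem IsSobolevLimit.not_le_abs_near_frontier {Ω : Set (E n)}
    (hΩ : IsBoundedLipschitzDomain Ω) {u : E n → ℝ} {G : E n → E n} (h : IsSobolevLimit Ω u G)
    (hu0 : ∀ x ∉ Ω, u x = 0) (hG0 : ∀ x ∉ Ω, G x = 0) {z : E n} (hz : z ∈ frontier Ω) {r η : ℝ}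
    (hr : 0 < r) (hη : 0 < η) : ¬ ∀ y ∈ ball z r, y ∈ Ω → η ≤ |u y| := by
  intro hle
  -- `T` vanishes near `0` and is `1` where `|s| ≥ η`, so `T ∘ u` is the indicator of `Ω` near `z`
  let b : ContDiffBump (0 : ℝ) := ⟨η / 4, η / 2, by positivity, by linarith⟩
  set T : ℝ → ℝ := fun s => 1 - b s with hTdef
  have hT : ContDiff ℝ ∞ T := contDiff_const.sub b.contDiff
  have hdT : ∀ s, deriv T s = -deriv b s := fun s => by
    rw [hTdef]
    simp
  have hbc : Continuous (deriv b) := (b.contDiff (n := 1)).continuous_deriv le_rfl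
  obtain ⟨B, hB⟩ := hbc.bounded_above_of_compact_support b.hasCompactSupport.deriv
  have hT0 : T 0 = 0 := by
    rw [hTdef]
    simp only
    rw [b.one_of_mem_closedBall (mem_closedBall_self b.rIn_pos.le), sub_self]
  have hTbig : ∀ s, η ≤ |s| → T s = 1 ∧ deriv T s = 0 := by
    intro s hs
    have hout : b.rOut = η / 2 := rfl
    have hns : s ∉ tsupport b := by
      rw [b.tsupport_eq, mem_closedBall, dist_zero_right, Real.norm_eq_abs, hout]
      linarith
    refine ⟨?_, ?_⟩
    · rw [hTdef]
      simp only
      rw [image_eq_zero_of_notMem_tsupport hns, sub_zero]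
    · rw [hdT, neg_eq_zero]
      exact image_eq_zero_of_notMem_tsupport fun hs' => hns (tsupport_deriv_subset hs')
  have hv := h.comp hT (B := B) (fun s => by
    rw [hdT, abs_neg]
    exact hB s) hT0
  set v : E n → ℝ := fun x => T (u x)
  have hG' : ∀ y ∈ ball z r, deriv T (u y) • G y = 0 := fun y hy => by
    by_cases hyΩ : y ∈ Ω
    · rw [(hTbig _ (hle y hy hyΩ)).2, zero_smul]
    · rw [hG0 y hyΩ, smul_zero]
  obtain ⟨C, hC⟩ := exists_isMollifierSeq (0 : E n) one_pos
  obtain ⟨k, hk⟩ := hC (fun j => 1 / ((j : ℝ) + 1)) (fun j => by positivity)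
    tendsto_one_div_add_atTop_nhds_zero_nat
  obtain ⟨x₁, hx₁, ρ₁, hρ₁, hball₁⟩ := hΩ.exists_ball_disjoint hz (half_pos hr)
  obtain ⟨x₂, hx₂Ω, hx₂⟩ : ∃ x ∈ Ω, x ∈ ball z (r / 2) := by
    have hzc : z ∈ closure Ω := frontier_subset_closure hz
    obtain ⟨x, hx, hd⟩ := Metric.mem_closure_iff.1 hzc (r / 2) (half_pos hr)
    exact ⟨x, hx, by rwa [mem_ball, dist_comm]⟩
  obtain ⟨ρ₂, hρ₂, hball₂⟩ := Metric.isOpen_iff.1 hΩ.isOpen x₂ hx₂Ω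
  set ρ := min (r / 2) (min ρ₁ ρ₂) with hρ
  have hρ0 : 0 < ρ := lt_min (half_pos hr) (lt_min hρ₁ hρ₂)
  obtain ⟨j, hj⟩ := ((tendsto_one_div_add_atTop_nhds_zero_nat (𝕜 := ℝ)).eventually_lt_const
    hρ0).exists
  have hj' : (1 / ((j : ℝ) + 1)) * (‖(0 : E n)‖ + 1) < ρ := by rw [norm_zero]; linarith
  have hsmooth := contDiff_mollify (hk.contDiff j) (hk.hasCompactSupport j)
    hv.integrable.locallyIntegrable
  have hconst : mollify (k j) v x₁ = mollify (k j) v x₂ := by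
    refine isOpen_ball.is_const_of_fderiv_eq_zero (𝕜 := ℝ)
      (convex_ball z (r / 2)).isPreconnected
      (hsmooth.differentiable (by simp)).differentiableOn (fun x hx => ?_) hx₁ hx₂
    rw [Pi.zero_apply, ← norm_eq_zero, ← norm_gradient,
      hv.gradient_mollify (hk.contDiff j) (hk.hasCompactSupport j),
      hk.mollify_eq_of_eqOn (c := 0) hj' (fun y hy => hG' y ?_), norm_zero]
    have h1 : dist y x < r / 2 := lt_of_lt_of_le hy (min_le_left _ _)
    have h2 : dist x z < r / 2 := hx
    exact (dist_triangle y x z).trans_lt (by linarith)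
  have hone : mollify (k j) v x₂ = 1 := by
    refine hk.mollify_eq_of_eqOn hj' fun y hy => ?_
    have h1 : dist y x₂ < r / 2 := lt_of_lt_of_le hy (min_le_left _ _)
    have h2 : dist x₂ z < r / 2 := hx₂
    refine (hTbig _ (hle y ((dist_triangle y x₂ z).trans_lt (by linarith)) (hball₂ ?_))).1
    exact ball_subset_ball ((min_le_right _ _).trans (min_le_right _ _)) hy
  have hzero : mollify (k j) v x₁ = 0 := by
    refine hk.mollify_eq_of_eqOn hj' fun y hy => ?_
    have : y ∉ Ω := hball₁ y
      (ball_subset_ball ((min_le_right _ _).trans (min_le_left _ _)) hy)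
    simp only [v, hu0 y this, hT0]
  rw [hone, hzero] at hconst
  exact zero_ne_one hconst

/-- A function in `W₀^{1,1}(Ω)` which is Hölder continuous in `Ω` stays so after extension by
zero. -/
theorem IsSobolevLimit.holder_indicator {Ω : Set (E n)} (hΩ : IsBoundedLipschitzDomain Ω)
    {φ : E n → ℝ} {G : E n → E n} (h : IsSobolevLimit Ω (Ω.indicator φ) G)
    (hG0 : ∀ x ∉ Ω, G x = 0) {γ H : ℝ≥0} (hγ : 0 < γ) (hφ : HolderOnWith H γ φ Ω) (x y : E n) :
    |Ω.indicator φ x - Ω.indicator φ y| ≤ H * ‖x - y‖ ^ (γ : ℝ) := by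
  have hφ' : ∀ x ∈ Ω, ∀ y ∈ Ω, |φ x - φ y| ≤ H * ‖x - y‖ ^ (γ : ℝ) := fun x hx y hy => by
    rw [← Real.dist_eq, ← dist_eq_norm]
    exact hφ.dist_le hx hy
  have key : ∀ x ∈ Ω, ∀ y ∉ Ω, |φ x| ≤ H * ‖x - y‖ ^ (γ : ℝ) := by
    intro x hx y hy
    obtain ⟨z, hz, hxz⟩ := exists_mem_frontier_infDist_compl_eq_dist hx
      (fun hu => hy (hu ▸ Set.mem_univ y))
    have hd : dist x z ≤ ‖x - y‖ := by
      rw [← hxz, ← dist_eq_norm]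
      exact infDist_le_dist_of_mem hy
    have hmain : |φ x| ≤ H * dist x z ^ (γ : ℝ) := by
      by_contra! hlt
      have hc : Continuous fun s : ℝ => H * (dist x z + s) ^ (γ : ℝ) :=
        continuous_const.mul ((continuous_const.add continuous_id).rpow_const
          fun _ => Or.inr γ.2)
      have h1 : ∀ᶠ s in 𝓝 (0 : ℝ), H * (dist x z + s) ^ (γ : ℝ) < |φ x| :=
        (hc.tendsto 0).eventually_lt_const (by simpa using hlt)
      obtain ⟨ε, hε, hs⟩ := Metric.eventually_nhds_iff.1 h1
      have h2 := hs (y := ε / 2) (by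
        rw [dist_zero_right, Real.norm_of_nonneg (by positivity)]
        linarith)
      refine h.not_le_abs_near_frontier hΩ (fun x hx => Set.indicator_of_notMem hx _) hG0 hz
        (half_pos hε) (sub_pos.2 h2) fun w hw hwΩ => ?_
      rw [Set.indicator_of_mem hwΩ]
      have h3 := hφ' x hx w hwΩ
      have h4 : ‖x - w‖ ≤ dist x z + ε / 2 := by
        rw [← dist_eq_norm]
        exact (dist_triangle_right x w z).trans (add_le_add le_rfl (le_of_lt hw))
      have h5 : H * ‖x - w‖ ^ (γ : ℝ) ≤ H * (dist x z + ε / 2) ^ (γ : ℝ) := by gcongr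
      have h6 := abs_sub_abs_le_abs_sub (φ x) (φ w)
      linarith
    exact hmain.trans (by gcongr)
  by_cases hx : x ∈ Ω <;> by_cases hy : y ∈ Ω
  · rw [Set.indicator_of_mem hx, Set.indicator_of_mem hy]
    exact hφ' x hx y hy
  · rw [Set.indicator_of_mem hx, Set.indicator_of_notMem hy, sub_zero]
    exact key x hx y hy
  · rw [Set.indicator_of_notMem hx, Set.indicator_of_mem hy, zero_sub, abs_neg, norm_sub_rev]
    exact key y hy x hx
  · rw [Set.indicator_of_notMem hx, Set.indicator_of_notMem hy, sub_zero, abs_zero]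
    positivity

/-! ### Approximation of bounded and of Hölder continuous functions -/

theorem modular_lt_top_of_bounded {Ω : Set (E n)} (hΩ : IsOpen Ω) (hb : Bornology.IsBounded Ω)
    {p q ϰ : ℝ} {a : E n → ℝ} (hp : 0 < p) (hq : 0 < q) (hϰ : 0 < ϰ) (hZ : MemZ Ω ϰ a)
    {ξ : E n → E n} {B : ℝ} (hB : ∀ x, ‖ξ x‖ ≤ B) : modular Ω p q a ξ < ⊤ := by
  obtain ⟨ha0, C, hC, hZ⟩ := hZ
  rcases Ω.eq_empty_or_nonempty with rfl | ⟨y, hy⟩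
  · simp [modular]
  obtain ⟨D, hD⟩ := Metric.isBounded_iff.1 hb
  have hle : ∀ x ∈ Ω, ENNReal.ofReal (‖ξ x‖ ^ p + a x * ‖ξ x‖ ^ q)
      ≤ ENNReal.ofReal (B ^ p + C * (a y + D ^ ϰ) * B ^ q) := fun x hx => by
    have h1 : ‖x - y‖ ≤ D := by
      rw [← dist_eq_norm]
      exact hD hx hy
    have h2 : a x ≤ C * (a y + D ^ ϰ) := (hZ x hx y hy).trans (by gcongr)
    have h3 := hB x
    have h4 := ha0 x hx
    have h5 := (norm_nonneg _).trans h1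
    have h6 := ha0 y hy
    gcongr
  refine (setLIntegral_mono' hΩ.measurableSet hle).trans_lt ?_
  rw [setLIntegral_const]
  exact ENNReal.mul_lt_top ENNReal.ofReal_lt_top hb.measure_lt_top

theorem modular_smul_le {Ω : Set (E n)} (hΩ : IsOpen Ω) {p q : ℝ} {a : E n → ℝ} (hp : 0 < p)
    (hq : 0 < q) (ha0 : ∀ x ∈ Ω, 0 ≤ a x) {θ : E n → ℝ} (hθ : ∀ x, |θ x| ≤ 1)
    (ξ : E n → E n) : modular Ω p q a (fun x => θ x • ξ x) ≤ modular Ω p q a ξ := by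
  refine setLIntegral_mono' hΩ.measurableSet fun x hx => ENNReal.ofReal_le_ofReal ?_
  have h1 : ‖θ x • ξ x‖ ≤ ‖ξ x‖ := by
    rw [norm_smul]
    exact mul_le_of_le_one_left (norm_nonneg _) (hθ x)
  have := ha0 x hx
  gcongr

theorem tendsto_modular_sum {Ω : Set (E n)} (hΩ : IsOpen Ω) {p q : ℝ} (hp : 1 < p) (hpq : p < q)
    {a : E n → ℝ} (ha : AEMeasurable a (volume.restrict Ω)) (ha0 : ∀ x ∈ Ω, 0 ≤ a x)
    {ι : Type*} (s : Finset ι) {ξ : ι → ℕ → E n → E n}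
    (hξ : ∀ i j, AEStronglyMeasurable (ξ i j) (volume.restrict Ω))
    (h : ∀ i, Tendsto (fun j => modular Ω p q a (ξ i j)) atTop (𝓝 0)) :
    Tendsto (fun j => modular Ω p q a fun x => ∑ i ∈ s, ξ i j x) atTop (𝓝 0) := by
  classical
  induction s using Finset.induction_on with
  | empty =>
    have : modular Ω p q a (fun _ => 0) = 0 := by
      simp [modular, Real.zero_rpow (show p ≠ 0 by linarith),
        Real.zero_rpow (show q ≠ 0 by linarith)]
    simp [this]
  | insert i s his ih =>
    simp only [Finset.sum_insert his]
    have h1 := ENNReal.Tendsto.const_mul (a := ENNReal.ofReal (2 ^ q)) ((h i).add ih)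
      (Or.inr ENNReal.ofReal_ne_top)
    rw [add_zero, mul_zero] at h1
    exact tendsto_of_tendsto_of_tendsto_of_le_of_le tendsto_const_nhds h1 (fun _ => zero_le)
      fun j => modular_add_le hΩ hp hpq ha ha0 (hξ i j)

theorem IsTestFunction.sum {Ω : Set (E n)} {ι : Type*} (s : Finset ι) {ψ : ι → E n → ℝ}
    (h : ∀ i ∈ s, IsTestFunction Ω (ψ i)) : IsTestFunction Ω fun x => ∑ i ∈ s, ψ i x := by
  classical
  induction s using Finset.induction_on with
  | empty =>
    simp only [Finset.sum_empty]
    exact ⟨contDiff_const, HasCompactSupport.zero, by simp [tsupport]⟩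
  | insert i s his ih =>
    simp only [Finset.sum_insert his]
    have h1 := h i (Finset.mem_insert_self i s)
    have h2 := ih fun j hj => h j (Finset.mem_insert_of_mem hj)
    exact ⟨h1.contDiff.add h2.contDiff, h1.hasCompactSupport.add h2.hasCompactSupport,
      (tsupport_add _ _).trans (Set.union_subset h1.tsupport_subset h2.tsupport_subset)⟩

theorem gradient_sum {ι : Type*} (s : Finset ι) {ψ : ι → E n → ℝ}
    (h : ∀ i ∈ s, ContDiff ℝ ∞ (ψ i)) (x : E n) :
    gradient (fun x => ∑ i ∈ s, ψ i x) x = ∑ i ∈ s, gradient (ψ i) x := by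
  simp only [gradient]
  rw [fderiv_fun_sum fun i hi => (h i hi).differentiable (by simp) x, map_sum]

/-- Products with test functions preserve `γ`-Hölder continuity of bounded functions. -/
theorem IsTestFunction.holder_mul {U : Set (E n)} {θ : E n → ℝ} (hθ : IsTestFunction U θ)
    {u : E n → ℝ} {B γ H : ℝ} (hγ0 : 0 ≤ γ) (hγ1 : γ ≤ 1) (hB : ∀ x, |u x| ≤ B) (hH0 : 0 ≤ H)
    (hH : ∀ x y, |u x - u y| ≤ H * ‖x - y‖ ^ γ) :
    ∃ H', 0 ≤ H' ∧ ∀ x y, |θ x * u x - θ y * u y| ≤ H' * ‖x - y‖ ^ γ := by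
  obtain ⟨A, hA0, hA, hA'⟩ := hθ.exists_bound
  have hB0 : 0 ≤ B := (abs_nonneg _).trans (hB 0)
  refine ⟨A * H + B * (2 * A), by positivity, fun x y => ?_⟩
  have hlip : |θ x - θ y| ≤ A * ‖x - y‖ :=
    Convex.norm_image_sub_le_of_norm_fderiv_le (𝕜 := ℝ)
      (fun z _ => hθ.contDiff.differentiable (by simp) z)
      (fun z _ => by rw [← norm_gradient]; exact hA' z) convex_univ (Set.mem_univ y)
      (Set.mem_univ x)
  have hθγ : |θ x - θ y| ≤ 2 * A * ‖x - y‖ ^ γ := by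
    rcases le_total ‖x - y‖ 1 with h | h
    · have h1 : ‖x - y‖ ≤ ‖x - y‖ ^ γ := by
        rcases (norm_nonneg (x - y)).eq_or_lt with h0 | h0
        · rw [← h0]
          positivity
        · simpa using Real.rpow_le_rpow_of_exponent_ge h0 h hγ1
      have : 0 ≤ A * ‖x - y‖ ^ γ := by positivity
      calc |θ x - θ y| ≤ A * ‖x - y‖ := hlip
        _ ≤ A * ‖x - y‖ ^ γ := by gcongr
        _ ≤ _ := by linarith
    · have h1 : 1 ≤ ‖x - y‖ ^ γ := Real.one_le_rpow h hγ0
      calc |θ x - θ y| ≤ |θ x| + |θ y| := abs_sub _ _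
        _ ≤ 2 * A := by linarith [hA x, hA y]
        _ ≤ _ := le_mul_of_one_le_right (by positivity) h1
  have : θ x * u x - θ y * u y = θ x * (u x - u y) + u y * (θ x - θ y) := by ring
  rw [this]
  calc |θ x * (u x - u y) + u y * (θ x - θ y)|
      ≤ |θ x| * |u x - u y| + |u y| * |θ x - θ y| := by
        rw [← abs_mul, ← abs_mul]
        exact abs_add_le _ _
    _ ≤ A * (H * ‖x - y‖ ^ γ) + B * (2 * A * ‖x - y‖ ^ γ) := by
        gcongr
        · exact hA x
        · exact hH x y
        · exact hB y
    _ = _ := by ring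

open scoped Pointwise in
/-- Mollification along an inward cone moves the support into the domain. -/
theorem IsMollifierSeq.eventually_isTestFunction {Ω : Set (E n)}
    {k : ℕ → E n → ℝ} {δ : ℕ → ℝ} {e : E n} {η C : ℝ} (hk : IsMollifierSeq k δ e η C)
    {w : E n → ℝ} (hw : Integrable w) {K : Set (E n)} (hK : IsCompact K)
    (hwK : ∀ x ∉ K, w x = 0) {d : ℝ} (hd : 0 < d)
    (hcone : ∀ y ∈ K, ∀ z ∈ closedBall e η, ∀ t, 0 < t → t < d → y + t • z ∈ Ω) :
    ∀ᶠ j in atTop, IsTestFunction Ω (mollify (k j) w) := by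
  filter_upwards [hk.tendsto.eventually_lt_const hd] with j hj
  have hc : IsCompact (tsupport (k j) + K) := (hk.hasCompactSupport j).isCompact.add hK
  have hsub : tsupport (mollify (k j) w) ⊆ tsupport (k j) + K := by
    refine closure_minimal ((support_convolution_subset _).trans
      (Set.add_subset_add (subset_tsupport _) fun x hx => ?_)) hc.isClosed
    by_contra hxK
    exact hx (hwK x hxK)
  refine ⟨contDiff_mollify (hk.contDiff j) (hk.hasCompactSupport j) hw.locallyIntegrable,
    hc.of_isClosed_subset (isClosed_tsupport _) hsub, hsub.trans ?_⟩
  rintro _ ⟨s, hs, y, hy, rfl⟩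
  have hpos := hk.pos j
  have h1 : (δ j)⁻¹ • s ∈ closedBall e η := by
    have h2 := hk.tsupport_subset j hs
    rw [mem_closedBall, dist_eq_norm] at h2 ⊢
    have h3 : (δ j)⁻¹ • s - e = (δ j)⁻¹ • (s - δ j • e) := by
      rw [smul_sub, inv_smul_smul₀ hpos.ne']
    rw [h3, norm_smul, norm_inv, Real.norm_of_nonneg hpos.le, inv_mul_le_iff₀ hpos]
    exact h2
  have := hcone y hy _ h1 (δ j) hpos hj
  rw [smul_inv_smul₀ hpos.ne'] at this
  simp only
  rwa [add_comm]

theorem IsMollifierSeq.abs_mollify_le {k : ℕ → E n → ℝ} {δ : ℕ → ℝ} {e : E n} {η C : ℝ}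
    (hk : IsMollifierSeq k δ e η C) {w : E n → ℝ} {M : ℝ} (hM : ∀ᵐ x, |w x| ≤ M) (j : ℕ)
    (x : E n) : |mollify (k j) w x| ≤ M := by
  rw [mollify_apply_swap, ← Real.norm_eq_abs]
  have h1 : Integrable fun t => k j (x - t) := (hk.integrable j).comp_sub_left x
  calc ‖∫ t, k j (x - t) • w t‖ ≤ ∫ t, k j (x - t) * M := by
        refine norm_integral_le_of_norm_le (h1.mul_const M) (hM.mono fun t ht => ?_)
        rw [norm_smul, Real.norm_of_nonneg (hk.nonneg j _)]
        exact mul_le_mul_of_nonneg_left ht (hk.nonneg j _)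
    _ = M := by
        rw [integral_mul_const, integral_sub_left_eq_self (fun t => k j t), hk.integral_eq,
          one_mul]

/-- A finite smooth partition of unity on the closure of the domain, each member of which comes
with an inward cone. -/
theorem IsBoundedLipschitzDomain.exists_partition {Ω : Set (E n)}
    (hΩ : IsBoundedLipschitzDomain Ω) :
    ∃ (N : ℕ) (θ : Fin N → E n → ℝ) (e : Fin N → E n) (η d : Fin N → ℝ),
      (∀ i, IsTestFunction Set.univ (θ i)) ∧ (∀ i x, 0 ≤ θ i x) ∧ (∀ i x, θ i x ≤ 1) ∧
      (∀ x ∈ closure Ω, ∑ i, θ i x = 1) ∧ (∀ i, 0 < η i) ∧ (∀ i, 0 < d i) ∧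
      ∀ i, ∀ y ∈ tsupport (θ i) ∩ closure Ω, ∀ z ∈ closedBall (e i) (η i), ∀ t, 0 < t → t < d i →
        y + t • z ∈ Ω := by
  have hcomp : IsCompact (closure Ω) := hΩ.isBounded.isCompact_closure
  choose! r e η d hr hη hd hcone using fun (x : E n) (hx : x ∈ closure Ω) =>
    hΩ.exists_inward_cone hx
  obtain ⟨t, ht, hcov⟩ := hcomp.elim_nhds_subcover (fun x => ball x (r x))
    fun x hx => ball_mem_nhds x (hr x hx)
  obtain ⟨f, hf⟩ := SmoothPartitionOfUnity.exists_isSubordinate (modelWithCornersSelf ℝ (E n))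
    hcomp.isClosed (fun i : t => ball (i : E n) (r i)) (fun _ => isOpen_ball) fun x hx => by
      obtain ⟨i, hi, hxi⟩ := Set.mem_iUnion₂.1 (hcov hx)
      exact Set.mem_iUnion.2 ⟨⟨i, hi⟩, hxi⟩
  let σ := (t.equivFin).symm
  refine ⟨t.card, fun i => f (σ i), fun i => e (σ i), fun i => η (σ i), fun i => d (σ i),
    fun i => ⟨(f (σ i)).contMDiff.contDiff, ?_, Set.subset_univ _⟩, fun i x => f.nonneg _ x,
    fun i x => f.le_one _ x, fun x hx => ?_, fun i => hη _ (ht _ (σ i).2),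
    fun i => hd _ (ht _ (σ i).2), fun i y hy => hcone _ (ht _ (σ i).2) y (hf _ hy.1) hy.2⟩
  · exact (isCompact_closedBall _ _).of_isClosed_subset (isClosed_tsupport _)
      ((hf (σ i)).trans ball_subset_closedBall)
  · rw [Equiv.sum_comp σ (fun i => f i x), ← finsum_eq_sum_of_fintype]
    exact f.sum_eq_one hx

/-- Approximation of bounded (`γ = 0`) and of Hölder continuous functions in `W(Ω)`, with a bound
in `L^∞` by the number of members of a partition of unity. -/
theorem IsBoundedLipschitzDomain.exists_approx_of_holder {Ω : Set (E n)}
    (hΩ : IsBoundedLipschitzDomain Ω) :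
    ∃ N : ℕ, ∀ {p q ϰ γ H B : ℝ} {a u : E n → ℝ} {G : E n → E n}, 1 < p → p < q → 0 < ϰ →
      AEMeasurable a (volume.restrict Ω) → MemZ Ω ϰ a → 0 ≤ γ → γ ≤ 1 → (q - p) * (1 - γ) ≤ ϰ →
      IsSobolevLimit Ω u G → (∀ x ∉ Ω, u x = 0) → (∀ x ∉ Ω, G x = 0) → 0 ≤ H →
      (∀ x y, |u x - u y| ≤ H * ‖x - y‖ ^ γ) → (∀ x, |u x| ≤ B) → modular Ω p q a G < ⊤ →
      ∃ ψ : ℕ → E n → ℝ, (∀ j, IsTestFunction Ω (ψ j)) ∧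
        Tendsto (fun j => eLpNorm (fun x => ψ j x - u x) 1 (volume.restrict Ω)) atTop (𝓝 0) ∧
        Tendsto (fun j => modular Ω p q a fun x => gradient (ψ j) x - G x) atTop (𝓝 0) ∧
        ∀ j, eLpNorm (ψ j) ⊤ (volume.restrict Ω) ≤ N * eLpNorm u ⊤ (volume.restrict Ω) := by
  obtain ⟨N, θ, e, η, d, hθ, hθ0, hθ1, hsum, hη, hd, hcone⟩ := hΩ.exists_partition
  refine ⟨N, fun {p q ϰ γ H B a u G} hp hpq hϰ ha hZ hγ0 hγ1 hγ hu hu0 hG0 hH0 hH hB hmod => ?_⟩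
  have ho := hΩ.isOpen
  choose C hC using fun i => exists_isMollifierSeq (e i) (hη i)
  choose k hk using fun i => hC i (fun j => 1 / ((j : ℝ) + 1)) (fun j => by positivity)
    tendsto_one_div_add_atTop_nhds_zero_nat
  have hδ1 : ∀ j : ℕ, 1 / ((j : ℝ) + 1) ≤ 1 := fun j => by
    rw [div_le_one (by positivity)]
    linarith [(Nat.cast_nonneg j : (0 : ℝ) ≤ j)]
  set w : Fin N → E n → ℝ := fun i x => θ i x * u x with hw
  set g : Fin N → E n → E n := fun i x => θ i x • G x + u x • gradient (θ i) x with hg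
  have hwg : ∀ i, IsSobolevLimit Ω (w i) (g i) := fun i => hu.mul_left (hθ i)
  have hgm : ∀ i, AEStronglyMeasurable (g i) volume := fun i => (hwg i).integrable_grad.1
  have hg0 : ∀ i, ∀ x ∉ Ω, g i x = 0 := fun i x hx => by
    simp only [hg, hG0 x hx, hu0 x hx, smul_zero, zero_smul, add_zero]
  have hwsum : ∀ x, ∑ i, w i x = u x := fun x => by
    by_cases hx : x ∈ Ω
    · simp only [hw]
      rw [← Finset.sum_mul, hsum x (subset_closure hx), one_mul]
    · simp only [hw, hu0 x hx, mul_zero, Finset.sum_const_zero]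
  have hgsum : ∀ x ∈ Ω, ∑ i, g i x = G x := fun x hx => by
    have h1 : ∑ i, gradient (θ i) x = 0 := by
      rw [← gradient_sum _ fun i _ => (hθ i).contDiff, gradient]
      have h2 : (fun x => ∑ i, θ i x) =ᶠ[𝓝 x] fun _ => 1 := by
        filter_upwards [ho.mem_nhds hx] with y hy
        exact hsum y (subset_closure hy)
      rw [h2.fderiv_eq, fderiv_fun_const, Pi.zero_apply, map_zero]
    simp only [hg]
    rw [Finset.sum_add_distrib, ← Finset.sum_smul, ← Finset.smul_sum, h1,
      hsum x (subset_closure hx), one_smul, smul_zero, add_zero]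
  have hmodg : ∀ i, modular Ω p q a (g i) < ⊤ := fun i => by
    obtain ⟨A, hA0, -, hA⟩ := (hθ i).exists_bound
    have hc := (hθ i).contDiff.continuous
    refine (modular_add_le ho hp hpq ha hZ.1
      (hc.aestronglyMeasurable.smul hu.integrable_grad.1).restrict).trans_lt
      (ENNReal.mul_lt_top ENNReal.ofReal_lt_top (ENNReal.add_lt_top.2 ⟨?_, ?_⟩))
    · refine (modular_smul_le ho (by linarith) (by linarith) hZ.1 (fun x => ?_) G).trans_lt hmod
      rw [abs_of_nonneg (hθ0 i x)]
      exact hθ1 i x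
    · refine modular_lt_top_of_bounded ho hΩ.isBounded (by linarith) (by linarith) hϰ hZ
        (B := B * A) fun x => ?_
      rw [norm_smul]
      exact mul_le_mul (hB x) (hA x) (norm_nonneg _) ((abs_nonneg _).trans (hB x))
  have htest : ∀ᶠ j in atTop, ∀ i, IsTestFunction Ω (mollify (k i j) (w i)) := by
    refine eventually_all.2 fun i => (hk i).eventually_isTestFunction (hwg i).integrable
      ((hθ i).hasCompactSupport.isCompact.inter_right isClosed_closure) (fun x hx => ?_) (hd i)
      (hcone i)
    by_cases h1 : x ∈ tsupport (θ i)
    · have h2 : x ∉ Ω := fun h => hx ⟨h1, subset_closure h⟩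
      simp only [hw, hu0 x h2, mul_zero]
    · simp only [hw, image_eq_zero_of_notMem_tsupport h1, zero_mul]
  have hsm : ∀ i j, ContDiff ℝ ∞ (mollify (k i j) (w i)) := fun i j =>
    contDiff_mollify ((hk i).contDiff j) ((hk i).hasCompactSupport j)
      (hwg i).integrable.locallyIntegrable
  obtain ⟨J, hJ⟩ := eventually_atTop.1 htest
  set Ψ : ℕ → E n → ℝ := fun j x => ∑ i, mollify (k i j) (w i) x with hΨ
  have hL1 : Tendsto (fun j => eLpNorm (fun x => Ψ j x - u x) 1 (volume.restrict Ω)) atTop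
      (𝓝 0) := by
    have h1 : Tendsto (fun j => ∑ i, eLpNorm (fun x => mollify (k i j) (w i) x - w i x) 1 volume)
        atTop (𝓝 (∑ _i : Fin N, 0)) :=
      tendsto_finsetSum _ fun i _ => (hk i).tendsto_eLpNorm_mollify_sub (hwg i).integrable
    rw [Finset.sum_const_zero] at h1
    refine tendsto_of_tendsto_of_tendsto_of_le_of_le tendsto_const_nhds h1 (fun _ => zero_le)
      fun j => ?_
    have h2 : (fun x => Ψ j x - u x) = ∑ i, fun x => mollify (k i j) (w i) x - w i x := by
      ext x
      simp only [hΨ]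
      rw [← hwsum, Finset.sum_apply, Finset.sum_sub_distrib]
    rw [h2]
    exact (eLpNorm_mono_measure _ Measure.restrict_le_self).trans
      (eLpNorm_sum_le (fun i _ => ((hsm i j).continuous.aestronglyMeasurable.sub
        (hwg i).integrable.1)) le_rfl)
  have hmodΨ : Tendsto (fun j => modular Ω p q a fun x => gradient (Ψ j) x - G x) atTop
      (𝓝 0) := by
    have h1 := tendsto_modular_sum ho hp hpq ha hZ.1 Finset.univ
      (ξ := fun i j x => gradient (mollify (k i j) (w i)) x - g i x)
      (fun i j => ((continuous_gradient (hsm i j)).aestronglyMeasurable.sub (hgm i)).restrict)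
      fun i => by
        obtain ⟨H', hH'0, hH'⟩ := (hθ i).holder_mul hγ0 hγ1 hB hH0 hH
        exact (hk i).tendsto_modular ho hp hpq hϰ ha hZ hγ0 hγ (hwg i) (hg0 i) hH'0 hH'
          (hmodg i) (hη i) hδ1
    refine h1.congr fun j => modular_congr ?_
    rw [EventuallyEq, ae_restrict_iff' ho.measurableSet]
    refine Eventually.of_forall fun x hx => ?_
    rw [Finset.sum_sub_distrib, hgsum x hx, gradient_sum _ fun i _ => hsm i j]
  have hsup : ∀ j, eLpNorm (Ψ j) ⊤ (volume.restrict Ω)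
      ≤ N * eLpNorm u ⊤ (volume.restrict Ω) := fun j => by
    have hfin : eLpNorm u ⊤ (volume.restrict Ω) < ⊤ := by
      rw [eLpNorm_exponent_top]
      exact eLpNormEssSup_lt_top_of_ae_bound (C := B) (Eventually.of_forall hB)
    set M := (eLpNorm u ⊤ (volume.restrict Ω)).toReal with hM
    have hM0 : 0 ≤ M := ENNReal.toReal_nonneg
    have huM : ∀ᵐ x, |u x| ≤ M := by
      have h1 : ∀ᵐ x ∂volume.restrict Ω, |u x| ≤ M := by
        have h2 := ae_le_eLpNormEssSup (f := u) (μ := volume.restrict Ω)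
        filter_upwards [h2] with x hx
        rw [← eLpNorm_exponent_top, ← ofReal_norm] at hx
        exact (ENNReal.ofReal_le_iff_le_toReal hfin.ne).1 hx
      rw [ae_restrict_iff' ho.measurableSet] at h1
      filter_upwards [h1] with x hx
      by_cases hxΩ : x ∈ Ω
      · exact hx hxΩ
      · rw [hu0 x hxΩ, abs_zero]
        exact hM0
    have hwM : ∀ i, ∀ᵐ x, |w i x| ≤ M := fun i => by
      filter_upwards [huM] with x hx
      simp only [hw]
      rw [abs_mul, abs_of_nonneg (hθ0 i x)]
      exact (mul_le_of_le_one_left (abs_nonneg _) (hθ1 i x)).trans hx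
    have h3 : ∀ x, ‖Ψ j x‖ ≤ N * M := fun x => by
      refine (norm_sum_le _ _).trans ?_
      refine (Finset.sum_le_sum fun i _ => (hk i).abs_mollify_le (hwM i) j x).trans ?_
      simp
    rw [eLpNorm_exponent_top]
    refine (eLpNormEssSup_le_of_ae_bound (Eventually.of_forall h3)).trans ?_
    rw [ENNReal.ofReal_mul (Nat.cast_nonneg _), ENNReal.ofReal_natCast, hM,
      ENNReal.ofReal_toReal hfin.ne]
  exact ⟨fun j => Ψ (j + J), fun j => IsTestFunction.sum _ fun i _ => hJ _ (by omega) i,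
    hL1.comp (tendsto_add_atTop_nat J), hmodΨ.comp (tendsto_add_atTop_nat J), fun j => hsup _⟩

/-! ### Truncation -/

/-- A smooth odd truncation, bounded by `1 / ε`, which does not increase absolute values and is a
contraction; it tends to the identity as `ε → 0`. -/
noncomputable def truncation (ε s : ℝ) : ℝ := s / √(1 + (ε * s) ^ 2)

theorem one_le_sqrt_one_add_sq (t : ℝ) : 1 ≤ √(1 + t ^ 2) :=
  Real.one_le_sqrt.2 (by nlinarith [sq_nonneg t])

theorem contDiff_truncation (ε : ℝ) : ContDiff ℝ ∞ (truncation ε) := by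
  have h1 : ContDiff ℝ ∞ fun s : ℝ => √(1 + (ε * s) ^ 2) :=
    ContDiff.sqrt (by fun_prop) fun s => by positivity
  exact contDiff_id.div h1 fun s => by positivity

theorem deriv_truncation (ε s : ℝ) : deriv (truncation ε) s = (√(1 + (ε * s) ^ 2) ^ 3)⁻¹ := by
  have h0 : 1 + (ε * s) ^ 2 ≠ 0 := by positivity
  have h1 : HasDerivAt (fun s : ℝ => 1 + (ε * s) ^ 2) (2 * (ε * s) * ε) s := by
    simpa using (((hasDerivAt_id s).const_mul ε).pow 2).const_add 1
  have h2 := (hasDerivAt_id s).div (h1.sqrt h0) (by positivity)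
  have h3 : deriv (truncation ε) s = _ := h2.deriv
  rw [h3]
  have h4 : √(1 + (ε * s) ^ 2) ^ 2 = 1 + (ε * s) ^ 2 := Real.sq_sqrt (by positivity)
  have h5 : √(1 + (ε * s) ^ 2) ≠ 0 := by positivity
  generalize √(1 + (ε * s) ^ 2) = r at h4 h5 ⊢
  simp only [id]
  field_simp
  rw [h4]
  ring

theorem abs_deriv_truncation_le_one (ε s : ℝ) : |deriv (truncation ε) s| ≤ 1 := by
  rw [deriv_truncation, abs_of_nonneg (by positivity)]
  exact inv_le_one_of_one_le₀ (one_le_pow₀ (one_le_sqrt_one_add_sq _))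

theorem abs_truncation_le (ε s : ℝ) : |truncation ε s| ≤ |s| := by
  rw [truncation, abs_div, abs_of_nonneg (Real.sqrt_nonneg _)]
  exact div_le_self (abs_nonneg _) (one_le_sqrt_one_add_sq _)

theorem abs_truncation_le_inv {ε : ℝ} (hε : 0 < ε) (s : ℝ) : |truncation ε s| ≤ 1 / ε := by
  rw [truncation, abs_div, abs_of_nonneg (Real.sqrt_nonneg _),
    div_le_div_iff₀ (by positivity) hε, one_mul]
  have h1 : |ε * s| ≤ √(1 + (ε * s) ^ 2) := Real.abs_le_sqrt (by linarith)
  rwa [abs_mul, abs_of_pos hε, mul_comm] at h1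

theorem tendsto_truncation (s : ℝ) : Tendsto (fun ε => truncation ε s) (𝓝 0) (𝓝 s) := by
  have : Continuous fun ε : ℝ => s / √(1 + (ε * s) ^ 2) :=
    continuous_const.div (by fun_prop) fun ε => by positivity
  simpa [truncation] using this.tendsto 0

theorem tendsto_deriv_truncation (s : ℝ) :
    Tendsto (fun ε => deriv (truncation ε) s) (𝓝 0) (𝓝 1) := by
  have : Continuous fun ε : ℝ => (√(1 + (ε * s) ^ 2) ^ 3)⁻¹ :=
    Continuous.inv₀ (by fun_prop) fun ε => by positivity
  simpa [deriv_truncation] using this.tendsto 0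

/-- Truncations of a function with finite modular converge to it in `L¹` and in the modular. -/
theorem IsSobolevLimit.tendsto_truncation {Ω : Set (E n)} (hΩ : IsOpen Ω) {p q : ℝ}
    {a : E n → ℝ} (hp : 0 < p) (hq : 0 < q) (ha : AEMeasurable a (volume.restrict Ω))
    (ha0 : ∀ x ∈ Ω, 0 ≤ a x) {u : E n → ℝ} {G : E n → E n} (hu : IsSobolevLimit Ω u G)
    (hmod : modular Ω p q a G < ⊤) {ε : ℕ → ℝ} (hε : Tendsto ε atTop (𝓝 0)) :
    Tendsto (fun j => eLpNorm (fun x => truncation (ε j) (u x) - u x) 1 (volume.restrict Ω))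
      atTop (𝓝 0) ∧
    Tendsto (fun j => modular Ω p q a fun x => deriv (truncation (ε j)) (u x) • G x - G x)
      atTop (𝓝 0) := by
  have hum := hu.integrable.1.restrict (s := Ω)
  have hGm := hu.integrable_grad.1.restrict (s := Ω)
  have hTm : ∀ j, AEStronglyMeasurable (fun x => truncation (ε j) (u x)) (volume.restrict Ω) :=
    fun j => (contDiff_truncation _).continuous.comp_aestronglyMeasurable hum
  have hTm' : ∀ j, AEStronglyMeasurable (fun x => deriv (truncation (ε j)) (u x) • G x - G x)
      (volume.restrict Ω) := fun j =>
    ((((contDiff_truncation _).continuous_deriv (by simp)).comp_aestronglyMeasurable hum).smul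
      hGm).sub hGm
  constructor
  · simp only [eLpNorm_one_eq_lintegral_enorm]
    rw [← lintegral_zero (μ := volume.restrict Ω)]
    refine tendsto_lintegral_of_dominated_convergence' (fun x => ENNReal.ofReal 2 * ‖u x‖ₑ)
      (fun j => ((hTm j).sub hum).enorm) (fun j => Eventually.of_forall fun x => ?_) ?_
      (Eventually.of_forall fun x => ?_)
    · simp only
      rw [← ofReal_norm, ← ofReal_norm, ← ENNReal.ofReal_mul (by norm_num)]
      refine ENNReal.ofReal_le_ofReal ((norm_sub_le _ _).trans ?_)
      have := abs_truncation_le (ε j) (u x)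
      rw [Real.norm_eq_abs, Real.norm_eq_abs]
      linarith
    · rw [lintegral_const_mul' _ _ ENNReal.ofReal_ne_top]
      exact ENNReal.mul_ne_top ENNReal.ofReal_ne_top hu.integrable.integrableOn.2.ne
    · have := (((DoublePhase.tendsto_truncation (u x)).comp hε).sub_const (u x)).enorm
      simpa using this
  · unfold modular
    rw [← lintegral_zero (μ := volume.restrict Ω)]
    have hle : ∀ j x, ‖deriv (truncation (ε j)) (u x) • G x - G x‖ ≤ ‖G x‖ := fun j x => by
      have h1 : deriv (truncation (ε j)) (u x) • G x - G x
          = (deriv (truncation (ε j)) (u x) - 1) • G x := by rw [sub_smul, one_smul]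
      have h2 := abs_le.1 (abs_deriv_truncation_le_one (ε j) (u x))
      have h3 : 0 ≤ deriv (truncation (ε j)) (u x) := by
        rw [deriv_truncation]
        positivity
      rw [h1, norm_smul]
      refine mul_le_of_le_one_left (norm_nonneg _) (abs_le.2 ⟨?_, ?_⟩) <;> linarith [h2.2]
    refine tendsto_lintegral_of_dominated_convergence'
      (fun x => ENNReal.ofReal (‖G x‖ ^ p + a x * ‖G x‖ ^ q))
      (fun j => (aemeasurable_doublePhase ha (hTm' j)).ennreal_ofReal) (fun j => ?_) hmod.ne
      (Eventually.of_forall fun x => ?_)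
    · refine (ae_restrict_iff' hΩ.measurableSet).2 (Eventually.of_forall fun x hx =>
        ENNReal.ofReal_le_ofReal ?_)
      have h1 := ha0 x hx
      have h2 := hle j x
      gcongr
    · have c1 : Tendsto (fun j => ‖deriv (truncation (ε j)) (u x) • G x - G x‖) atTop (𝓝 0) := by
        have h1 := (((tendsto_deriv_truncation (u x)).comp hε).smul_const (G x)).sub_const (G x)
        simpa using h1.norm
      have c2 := (c1.rpow_const (p := p) (Or.inr hp.le)).add
        ((c1.rpow_const (p := q) (Or.inr hq.le)).const_mul (a x))
      rw [Real.zero_rpow hp.ne', Real.zero_rpow hq.ne', mul_zero, add_zero] at c2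
      simpa using ENNReal.tendsto_ofReal c2

/-! ### Norm and modular convergence -/

theorem modular_smul_le_mul {Ω : Set (E n)} (hΩ : IsOpen Ω) {p q : ℝ} {a : E n → ℝ} {s c : ℝ}
    (hs : 0 ≤ s) (hc : 0 ≤ c) (hsp : s ^ p ≤ c) (hsq : s ^ q ≤ c) (ha0 : ∀ x ∈ Ω, 0 ≤ a x)
    (ξ : E n → E n) :
    modular Ω p q a (fun x => s • ξ x) ≤ ENNReal.ofReal c * modular Ω p q a ξ := by
  unfold modular
  rw [← lintegral_const_mul' _ _ ENNReal.ofReal_ne_top]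
  refine setLIntegral_mono' hΩ.measurableSet fun x hx => ?_
  have := ha0 x hx
  rw [← ENNReal.ofReal_mul hc]
  refine ENNReal.ofReal_le_ofReal ?_
  rw [norm_smul, Real.norm_of_nonneg hs, Real.mul_rpow hs (norm_nonneg _),
    Real.mul_rpow hs (norm_nonneg _)]
  calc s ^ p * ‖ξ x‖ ^ p + a x * (s ^ q * ‖ξ x‖ ^ q)
      ≤ c * ‖ξ x‖ ^ p + a x * (c * ‖ξ x‖ ^ q) := by gcongr
    _ = _ := by ring

theorem tendsto_luxemburgNorm_iff {Ω : Set (E n)} (hΩ : IsOpen Ω) {p q : ℝ} {a : E n → ℝ}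
    (hp : 1 < p) (hpq : p < q) (ha0 : ∀ x ∈ Ω, 0 ≤ a x) {ξ : ℕ → E n → E n} :
    Tendsto (fun k => luxemburgNorm Ω p q a (ξ k)) atTop (𝓝 0) ↔
      Tendsto (fun k => modular Ω p q a (ξ k)) atTop (𝓝 0) := by
  constructor
  · intro h
    rw [ENNReal.tendsto_nhds_zero]
    intro ε hε
    filter_upwards [h.eventually_lt_const (lt_min hε one_pos)] with k hk
    simp only [luxemburgNorm, iInf_lt_iff] at hk
    obtain ⟨t, ht0, hmod, ht⟩ := hk
    have ht1 : (t : ℝ) ≤ 1 := by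
      have := (ht.trans_le (min_le_right _ _)).le
      exact_mod_cast this
    have ht0' : (0 : ℝ) < t := ht0
    have h1 := modular_smul_le_mul hΩ (p := p) (q := q) (s := t) (c := t) ht0'.le ht0'.le
      (Real.rpow_le_self_of_le_one ht0'.le ht1 hp.le)
      (Real.rpow_le_self_of_le_one ht0'.le ht1 (hp.trans hpq).le) ha0 fun x => (t : ℝ)⁻¹ • ξ k x
    simp only [smul_inv_smul₀ ht0'.ne'] at h1
    refine h1.trans ((mul_le_of_le_one_right zero_le hmod).trans ?_)
    rw [ENNReal.ofReal_coe_nnreal]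
    exact (ht.trans_le (min_le_left _ _)).le
  · intro h
    rw [ENNReal.tendsto_nhds_zero]
    intro ε hε
    obtain ⟨t, ht0, ht⟩ := ENNReal.lt_iff_exists_nnreal_btwn.1 (lt_min hε one_pos)
    have ht0' : (0 : ℝ) < t := by exact_mod_cast ht0
    have ht1 : (t : ℝ) ≤ 1 := by
      have := (ht.trans_le (min_le_right _ _)).le
      exact_mod_cast this
    have hpos : 0 < (t : ℝ) ^ q := Real.rpow_pos_of_pos ht0' q
    filter_upwards [h.eventually_le_const (ENNReal.ofReal_pos.2 hpos)] with k hk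
    have hinv : 1 ≤ (t : ℝ)⁻¹ := (one_le_inv₀ ht0').2 ht1
    have h1 := modular_smul_le_mul hΩ (p := p) (q := q) (s := (t : ℝ)⁻¹) (c := (t : ℝ)⁻¹ ^ q)
      (by positivity) (by positivity) (Real.rpow_le_rpow_of_exponent_le hinv hpq.le) le_rfl ha0
      (ξ k)
    have h2 : modular Ω p q a (fun x => (t : ℝ)⁻¹ • ξ k x) ≤ 1 := by
      refine h1.trans ((mul_le_mul_right hk _).trans (le_of_eq ?_))
      rw [← ENNReal.ofReal_mul (by positivity), Real.inv_rpow ht0'.le,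
        inv_mul_cancel₀ hpos.ne', ENNReal.ofReal_one]
    refine le_trans ?_ (ht.trans_le (min_le_left _ _)).le
    exact (iInf_le_of_le t (iInf_le_of_le (by exact_mod_cast ht0') (iInf_le _ h2)))

/-- Convergence in `W(Ω)` is convergence in `L¹` together with modular convergence of the
gradients. -/
theorem tendstoW_iff {Ω : Set (E n)} (hΩ : IsOpen Ω) {p q : ℝ} {a : E n → ℝ}
    (hp : 1 < p) (hpq : p < q) (ha0 : ∀ x ∈ Ω, 0 ≤ a x) {u : ℕ → E n → ℝ} {v : E n → ℝ}
    {G : ℕ → E n → E n} {H : E n → E n} (hu : ∀ k, IsWeakGradient Ω (u k) (G k))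
    (hv : IsWeakGradient Ω v H) :
    TendstoW Ω p q a u v ↔
      Tendsto (fun k => eLpNorm (fun x => u k x - v x) 1 (volume.restrict Ω)) atTop (𝓝 0) ∧
      Tendsto (fun k => modular Ω p q a fun x => G k x - H x) atTop (𝓝 0) := by
  have hmod : ∀ k, modular Ω p q a (weakGradient Ω fun x => u k x - v x)
      = modular Ω p q a fun x => G k x - H x := fun k =>
    modular_congr (((hu k).sub hv).weakGradient_ae_eq hΩ)
  have hlux := tendsto_luxemburgNorm_iff hΩ hp hpq ha0
    (ξ := fun k => weakGradient Ω fun x => u k x - v x)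
  simp only [hmod] at hlux
  rw [← hlux]
  simp only [TendstoW, wNorm]
  constructor
  · intro h
    exact ⟨tendsto_of_tendsto_of_tendsto_of_le_of_le tendsto_const_nhds h (fun _ => zero_le)
        fun k => le_self_add,
      tendsto_of_tendsto_of_tendsto_of_le_of_le tendsto_const_nhds h (fun _ => zero_le)
        fun k => le_add_self⟩
  · rintro ⟨h1, h2⟩
    simpa using h1.add h2

/-! ### Density of smooth functions -/

theorem MemW.isSobolevLimit {Ω : Set (E n)} (hΩ : IsOpen Ω) {p q : ℝ} {a φ : E n → ℝ}
    (h : MemW Ω p q a φ) :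
    IsSobolevLimit Ω (Ω.indicator φ) (Ω.indicator (weakGradient Ω φ)) ∧
      modular Ω p q a (Ω.indicator (weakGradient Ω φ)) < ⊤ := by
  refine ⟨h.1.isSobolevLimit hΩ, ?_⟩
  rw [modular_congr (indicator_ae_eq_restrict hΩ.measurableSet)]
  exact h.2

/-- Approximation of the extension by zero, in `L¹` and in the modular, is approximation in
`W(Ω)`. -/
theorem smoothlyApproximable_of_indicator {Ω : Set (E n)} (hΩ : IsOpen Ω) {p q : ℝ}
    {a φ : E n → ℝ} (hp : 1 < p) (hpq : p < q) (ha0 : ∀ x ∈ Ω, 0 ≤ a x) {c : ℝ≥0}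
    (hφ : MemW Ω p q a φ) {ψ : ℕ → E n → ℝ} (hψ : ∀ j, IsTestFunction Ω (ψ j))
    (h1 : Tendsto (fun j => eLpNorm (fun x => ψ j x - Ω.indicator φ x) 1 (volume.restrict Ω))
      atTop (𝓝 0))
    (h2 : Tendsto (fun j => modular Ω p q a fun x =>
      gradient (ψ j) x - Ω.indicator (weakGradient Ω φ) x) atTop (𝓝 0))
    (h3 : ∀ j, eLpNorm (ψ j) ⊤ (volume.restrict Ω)
      ≤ c * eLpNorm (Ω.indicator φ) ⊤ (volume.restrict Ω)) :
    SmoothlyApproximable Ω p q a c φ := by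
  have e1 : Ω.indicator φ =ᵐ[volume.restrict Ω] φ := indicator_ae_eq_restrict hΩ.measurableSet
  have e2 : Ω.indicator (weakGradient Ω φ) =ᵐ[volume.restrict Ω] weakGradient Ω φ :=
    indicator_ae_eq_restrict hΩ.measurableSet
  refine ⟨ψ, hψ, (tendstoW_iff hΩ hp hpq ha0 (fun j => (hψ j).isWeakGradient)
    hφ.1.1.isWeakGradient).2 ⟨h1.congr fun j => eLpNorm_congr_ae ?_,
      h2.congr fun j => modular_congr ?_⟩, fun _ j => ?_⟩
  · filter_upwards [e1] with x hx
    rw [hx]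
  · filter_upwards [e2] with x hx
    rw [hx]
  · rw [← eLpNorm_congr_ae e1]
    exact h3 j

end DoublePhase

open DoublePhase

theorem mainTheorem2 (n : ℕ) (hn : 1 ≤ n) (Ω : Set (DoublePhase.E n))
    (hΩ : DoublePhase.IsBoundedLipschitzDomain Ω) :
    ∃ c : ℝ≥0, 0 < c ∧
      ∀ (p q ϰ : ℝ) (a : DoublePhase.E n → ℝ), 1 < p → p < q → 0 < ϰ →
        AEMeasurable a (volume.restrict Ω) → DoublePhase.MemZ Ω ϰ a →
        (q - p ≤ ϰ →
          ∀ φ : DoublePhase.E n → ℝ, DoublePhase.MemW Ω p q a φ →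
            DoublePhase.SmoothlyApproximable Ω p q a c φ) ∧
        (∀ γ : ℝ≥0, 0 < γ → γ ≤ 1 → (q - p) * (1 - (γ : ℝ)) ≤ ϰ →
          ∀ φ : DoublePhase.E n → ℝ, DoublePhase.MemW Ω p q a φ →
            (∃ H : ℝ≥0, HolderOnWith H γ φ Ω) →
            DoublePhase.SmoothlyApproximable Ω p q a c φ) ∧
        (∀ (u : ℕ → DoublePhase.E n → ℝ) (v : DoublePhase.E n → ℝ),
          (∀ k, DoublePhase.MemW Ω p q a (u k)) → DoublePhase.MemW Ω p q a v →
            (DoublePhase.TendstoW Ω p q a u v ↔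
              Tendsto (fun k => eLpNorm (fun x => u k x - v x) 1 (volume.restrict Ω))
                atTop (𝓝 0) ∧
              Tendsto (fun k => DoublePhase.modular Ω p q a (fun x =>
                DoublePhase.weakGradient Ω (u k) x - DoublePhase.weakGradient Ω v x))
                atTop (𝓝 0))) := by
  have ho := hΩ.isOpen
  obtain ⟨N, hN⟩ := hΩ.exists_approx_of_holder
  -- `N` is zero if `Ω` is empty, hence the constant `N + 1`
  refine ⟨N + 1, by positivity, fun p q ϰ a hp hpq hϰ ha hZ => ⟨fun hle φ hφ => ?_,
    fun γ hγ0 hγ1 hγ φ hφ hH => ?_, fun u v hu hv => tendstoW_iff ho hp hpq hZ.1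
      (fun k => (hu k).1.1.isWeakGradient) hv.1.1.isWeakGradient⟩⟩
  · obtain ⟨hs, hmod⟩ := hφ.isSobolevLimit ho
    set u := Ω.indicator φ with hu
    set G := Ω.indicator (weakGradient Ω φ) with hG
    have hu0 : ∀ x ∉ Ω, u x = 0 := fun x hx => Set.indicator_of_notMem hx _
    have hG0 : ∀ x ∉ Ω, G x = 0 := fun x hx => Set.indicator_of_notMem hx _
    -- the `j`-th truncation is bounded by `j + 1`, so it is approximable with `γ = 0`
    set ε : ℕ → ℝ := fun j => 1 / ((j : ℝ) + 1) with hε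
    have hεpos : ∀ j, 0 < ε j := fun j => by positivity
    have hεlim : Tendsto ε atTop (𝓝 0) := tendsto_one_div_add_atTop_nhds_zero_nat
    have hε' : Tendsto (fun j => ENNReal.ofReal (ε j)) atTop (𝓝 0) := by
      simpa using ENNReal.tendsto_ofReal hεlim
    obtain ⟨ht1, ht2⟩ := hs.tendsto_truncation ho (by linarith) (by linarith) ha hZ.1 hmod hεlim
    set v : ℕ → E n → ℝ := fun j x => truncation (ε j) (u x) with hv
    set Gv : ℕ → E n → E n := fun j x => deriv (truncation (ε j)) (u x) • G x with hGv
    have hvS : ∀ j, IsSobolevLimit Ω (v j) (Gv j) := fun j =>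
      hs.comp (contDiff_truncation _) (abs_deriv_truncation_le_one _) (by simp [truncation])
    have happ : ∀ j, ∃ ψ, IsTestFunction Ω ψ ∧
        eLpNorm (fun x => ψ x - v j x) 1 (volume.restrict Ω) ≤ ENNReal.ofReal (ε j) ∧
        modular Ω p q a (fun x => gradient ψ x - Gv j x) ≤ ENNReal.ofReal (ε j) ∧
        eLpNorm ψ ⊤ (volume.restrict Ω) ≤ N * eLpNorm (v j) ⊤ (volume.restrict Ω) := by
      intro j
      have hB : ∀ x, |v j x| ≤ 1 / ε j := fun x => abs_truncation_le_inv (hεpos j) _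
      obtain ⟨ψ, hψ, h1, h2, h3⟩ := hN (γ := 0) (H := 1 / ε j + 1 / ε j) (B := 1 / ε j) hp hpq hϰ
        ha hZ le_rfl zero_le_one (by linarith) (hvS j)
        (fun x hx => by simp [hv, hu0 x hx, truncation])
        (fun x hx => by simp only [hGv, hG0 x hx, smul_zero])
        (by have := hεpos j; positivity)
        (fun x y => by
          rw [Real.rpow_zero, mul_one]
          exact (abs_sub _ _).trans (add_le_add (hB x) (hB y)))
        hB ((modular_smul_le ho (by linarith) (by linarith) hZ.1
          (fun x => abs_deriv_truncation_le_one (ε j) (u x)) G).trans_lt hmod)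
      have hpos : 0 < ENNReal.ofReal (ε j) := ENNReal.ofReal_pos.2 (hεpos j)
      obtain ⟨i, hi1, hi2⟩ :=
        ((h1.eventually_le_const hpos).and (h2.eventually_le_const hpos)).exists
      exact ⟨ψ i, hψ i, hi1, hi2, h3 i⟩
    choose ψ hψ hψ1 hψ2 hψ3 using happ
    have hum : AEStronglyMeasurable u (volume.restrict Ω) := hs.integrable.1.restrict
    have hψm : ∀ j, AEStronglyMeasurable (fun x => ψ j x - v j x) (volume.restrict Ω) := fun j =>
      ((hψ j).integrable.1.sub (hvS j).integrable.1).restrict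
    have hψm' : ∀ j, AEStronglyMeasurable (fun x => gradient (ψ j) x - Gv j x)
        (volume.restrict Ω) := fun j =>
      ((hψ j).integrable_gradient.1.sub (hvS j).integrable_grad.1).restrict
    refine smoothlyApproximable_of_indicator ho hp hpq hZ.1 hφ hψ ?_ ?_ fun j => ?_
    · have h1 := hε'.add ht1
      rw [add_zero] at h1
      refine tendsto_of_tendsto_of_tendsto_of_le_of_le tendsto_const_nhds h1 (fun _ => zero_le)
        fun j => ?_
      have h2 : (fun x => ψ j x - u x) = (fun x => ψ j x - v j x) + fun x => v j x - u x := by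
        ext x
        simp
      rw [h2]
      refine (eLpNorm_add_le (hψm j) ((hvS j).integrable.1.restrict.sub hum) le_rfl).trans ?_
      exact add_le_add (hψ1 j) le_rfl
    · have h1 := ENNReal.Tendsto.const_mul (a := ENNReal.ofReal (2 ^ q)) (hε'.add ht2)
        (Or.inr ENNReal.ofReal_ne_top)
      rw [add_zero, mul_zero] at h1
      refine tendsto_of_tendsto_of_tendsto_of_le_of_le tendsto_const_nhds h1 (fun _ => zero_le)
        fun j => ?_
      have h2 : (fun x => gradient (ψ j) x - G x)
          = fun x => (gradient (ψ j) x - Gv j x) + (Gv j x - G x) := by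
        ext1 x
        abel
      simp only [← hG]
      rw [h2]
      refine (modular_add_le ho hp hpq ha hZ.1 (hψm' j)).trans ?_
      gcongr
      exact hψ2 j
    · refine (hψ3 j).trans ?_
      push_cast
      gcongr
      · exact le_self_add
      · exact eLpNorm_mono fun x => abs_truncation_le _ _
  · obtain ⟨hs, hmod⟩ := hφ.isSobolevLimit ho
    obtain ⟨H, hH⟩ := hH
    have hu0 : ∀ x ∉ Ω, Ω.indicator φ x = 0 := fun x hx => Set.indicator_of_notMem hx _
    have hG0 : ∀ x ∉ Ω, Ω.indicator (weakGradient Ω φ) x = 0 :=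
      fun x hx => Set.indicator_of_notMem hx _
    have hhol := hs.holder_indicator hΩ hG0 hγ0 hH
    -- the extension by zero is bounded because it is Hölder continuous and vanishes off `Ω`
    obtain ⟨B, hB⟩ : ∃ B, ∀ x, |Ω.indicator φ x| ≤ B := by
      obtain ⟨D, hD⟩ := Metric.isBounded_iff.1 hΩ.isBounded
      rcases Ω.eq_empty_or_nonempty with rfl | ⟨y, hy⟩
      · exact ⟨0, by simp⟩
      refine ⟨|Ω.indicator φ y| + H * D ^ (γ : ℝ), fun x => ?_⟩
      have hD0 : 0 ≤ D := dist_nonneg.trans (hD hy hy)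
      by_cases hx : x ∈ Ω
      · have h1 : ‖x - y‖ ≤ D := by
          rw [← dist_eq_norm]
          exact hD hx hy
        have h2 : (H : ℝ) * ‖x - y‖ ^ (γ : ℝ) ≤ H * D ^ (γ : ℝ) := by gcongr
        have h3 := abs_sub_abs_le_abs_sub (Ω.indicator φ x) (Ω.indicator φ y)
        linarith [hhol x y]
      · rw [hu0 x hx, abs_zero]
        positivity
    obtain ⟨ψ, hψ, h1, h2, h3⟩ := hN hp hpq hϰ ha hZ γ.2 (by exact_mod_cast hγ1) hγ hs hu0 hG0
      H.2 hhol hB hmod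
    refine smoothlyApproximable_of_indicator ho hp hpq hZ.1 hφ hψ h1 h2 fun j => (h3 j).trans ?_
    push_cast
    gcongr
    exact le_self_add
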